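/- **Proposition 2.1.** Let $N,k,\beta\ge 1$ be integers. Let $\mathbb{E}_{A\in U(N)}$ denote expectation with respect to the Haar probability measure on the unitary group $U(N)$. For $A\in U(N)$ and $\theta\in\mathbb{R}$ put $P_N(A,\theta)=\det(I-Ae^{-i\theta})$, and define $$\mathrm{Mom}_N(k,\beta)=\mathbb{E}_{A\in U(N)}\left(\left(\frac1{2\pi}\int_0^{2\pi}|P_N(A,\theta)|^{2\beta}\,d\theta\right)^k\right).$$ For a partition $\lambda$ let $s_\lambda(x_1,\dots,x_n)=\sum_T x_1^{t_1}\cdots x_n^{t_n}$ be the Schur polynomial in $n$ variables, where $T$ runs over the semistandard Young tableaux (SSYT) of shape $\lambda$ with entries in $\{1,\dots,n\}$ and $t_i$ is the number of entries of $T$ equal to $i$. Write $\langle N^{k\beta}\rangle=(N,\dots,N)$ for the partition with $k\beta$ parts equal to $N$; its diagram is the rectangle with $k\beta$ rows and $N$ columns. 1. For all $\theta_1,\dots,\theta_k\in\mathbb{R}$, $$\mathbb{E}_{A\in U(N)}\left(\prod_{j=1}^k|P_N(A,\theta_j)|^{2\beta}\right)=\frac{s_{\langle N^{k\beta}\rangle}(e^{i\underline{\theta}})}{\prod_{j=1}^k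 e^{iN\beta\theta_j}},$$ where $e^{i\underline\theta}$ is the vector of length $2k\beta$ $$e^{i\underline{\theta}}=(\overbrace{e^{i\theta_1},\dots,e^{i\theta_1}}^{\beta},\dots,\overbrace{e^{i\theta_k},\dots,e^{i\theta_k}}^{\beta},\overbrace{e^{i\theta_1},\dots,e^{i\theta_1}}^{\beta},\dots,\overbrace{e^{i\theta_k},\dots,e^{i\theta_k}}^{\beta}).$$ 2. $\mathrm{Mom}_N(k,\beta)$ equals the number of restricted SSYT, that is, of SSYT of rectangular shape with $k\beta$ rows and $N$ columns and with entries in $\{1,\dots,2k\beta\}$ such that, for each $j\in\{1,\dots,k\}$, exactly $N\beta$ of the entries lie in $\{2\beta(j-1)+1,\dots,2\beta j\}$. 3. For fixed $k$ and $\beta$ there is a real polynomial $p$ of degree $k^2\beta^2$ such that $\mathrm{Mom}_N(k,\beta)\le p(N)$ for all integers $N\ge 1$. -/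

import Mathlib

open MeasureTheory

namespace CUE

noncomputable section

/-! ### The unitary group `U(N)` with its Haar probability measure -/

/-- The unitary group `U(N)`. -/
abbrev U (N : ℕ) := Matrix.unitaryGroup (Fin N) ℂ

/-- `U(N)` carries its Borel σ-algebra. -/
instance instMeasurableSpaceU (N : ℕ) : MeasurableSpace (U N) := borel _

instance instBorelSpaceU (N : ℕ) : BorelSpace (U N) := ⟨rfl⟩

instance instCompactSpaceU (N : ℕ) : CompactSpace (U N) := by
  refine isCompact_iff_compactSpace.mp ?_
  have hK : IsCompact
      (Set.pi Set.univ fun _ : Fin N => Set.pi Set.univ fun _ : Fin N =>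
        Metric.closedBall (0 : ℂ) 1) :=
    isCompact_univ_pi fun _ => isCompact_univ_pi fun _ => isCompact_closedBall _ _
  refine hK.of_isClosed_subset (isClosed_unitary (R := Matrix (Fin N) (Fin N) ℂ)) ?_
  intro A hA i _ j _
  simpa using entry_norm_bound_of_unitary hA i j

/-- The Haar measure on the compact group `U(N)`, normalised to total mass one. -/
def haarU (N : ℕ) : Measure (U N) := Measure.haarMeasure ⊤

/-- The expectation over `A ∈ U(N)` distributed according to the Haar probability measure. -/
def expectationU {N : ℕ} (f : U N → ℝ) : ℝ := ∫ A, f A ∂(haarU N)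

/-- `P_N(A, θ) = det (I - A e^{-iθ})`. -/
def charP {N : ℕ} (A : U N) (θ : ℝ) : ℂ :=
  (1 - Complex.exp (-(θ * Complex.I)) • (A : Matrix (Fin N) (Fin N) ℂ)).det

/-- The moments of moments:
`Mom_N(k, β) = E_{A ∈ U(N)} (((1 / 2π) ∫_0^{2π} |P_N(A, θ)|^{2β} dθ)^k)`. -/
def Mom (N k β : ℕ) : ℝ :=
  expectationU fun A : U N =>
    ((1 / (2 * Real.pi)) * ∫ θ in (0 : ℝ)..(2 * Real.pi), ‖charP A θ‖ ^ (2 * β)) ^ k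

/-! ### Semistandard tableaux with bounded entries and Schur polynomials -/

/-- Semistandard Young tableaux of shape `μ` with entries in an alphabet of `n` letters. Entries
are numbered from `0` as in Mathlib: the letter `m + 1` of the alphabet `{1, …, n}` is `m`. -/
def SSYT (μ : YoungDiagram) (n : ℕ) :=
  {T : SemistandardYoungTableau μ // ∀ c ∈ μ.cells, T c.1 c.2 < n}

instance instFiniteSSYT (μ : YoungDiagram) (n : ℕ) : Finite (SSYT μ n) := by
  let f : SSYT μ n → (μ.cells → Fin n) := fun T c => ⟨T.1 c.1.1 c.1.2, T.2 c.1 c.2⟩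
  refine Finite.of_injective f ?_
  intro S T h
  refine Subtype.ext (SemistandardYoungTableau.ext fun i j => ?_)
  by_cases hc : (i, j) ∈ μ
  · have h' := congrFun h ⟨(i, j), hc⟩
    exact congrArg Fin.val h'
  · rw [S.1.zeros hc, T.1.zeros hc]

instance instFintypeSSYT (μ : YoungDiagram) (n : ℕ) : Fintype (SSYT μ n) := Fintype.ofFinite _

/-- `T.content m` is the number of times that the letter `m` occurs in the tableau `T`. -/
def SSYT.content {μ : YoungDiagram} {n : ℕ} (T : SSYT μ n) (m : ℕ) : ℕ :=
  (μ.cells.filter fun c => T.1 c.1 c.2 = m).card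

/-- The Schur polynomial `s_μ(x_1, …, x_n) = ∑_T x_1^{t_1} ⋯ x_n^{t_n}` in `n` variables; `T` runs
over the semistandard Young tableaux of shape `μ` on `n` letters, and `t_i` is the number of
times that the `i`-th letter occurs in `T`. -/
def schurPoly (μ : YoungDiagram) (n : ℕ) : MvPolynomial (Fin n) ℤ :=
  ∑ T : SSYT μ n, ∏ i : Fin n, MvPolynomial.X i ^ T.content i

/-- The rectangular Young diagram with `r` rows and `c` columns, that is, the diagram of the
partition `⟨c^r⟩ = (c, …, c)` with `r` parts. -/
def rect (r c : ℕ) : YoungDiagram where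
  cells := Finset.range r ×ˢ Finset.range c
  isLowerSet := by
    intro a b hab ha
    simp only [Finset.coe_product, Finset.coe_range, Set.mem_prod, Set.mem_Iio] at ha ⊢
    exact ⟨lt_of_le_of_lt hab.1 ha.1, lt_of_le_of_lt hab.2 ha.2⟩

/-- The vector `e^{iθ}` of length `2kβ`: two consecutive blocks of length `kβ`, each of which
lists `e^{iθ_1}, …, e^{iθ_k}` in this order, each of them `β` times in a row.
(`Fin.modNat` is the position inside a block; `Fin.divNat` divides that position by `β`.) -/
def schurVector (k β : ℕ) (θ : Fin k → ℝ) : Fin (2 * (k * β)) → ℂ := fun i =>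
  Complex.exp (θ (Fin.divNat (Fin.modNat i)) * Complex.I)

/-- A semistandard Young tableau of rectangular shape with `kβ` rows and `N` columns on `2kβ`
letters is restricted if, for each `j ∈ {1, …, k}`, exactly `Nβ` of its entries are among the
letters `2β(j-1)+1, …, 2βj`. (Here both the letters and `j` are numbered from `0`.) -/
def IsRestricted {N k β : ℕ} (T : SSYT (rect (k * β) N) (2 * (k * β))) : Prop :=
  ∀ j : Fin k, ∑ m ∈ Finset.Ico (2 * β * (j : ℕ)) (2 * β * ((j : ℕ) + 1)), T.content m = N * β

/-- The number of restricted semistandard Young tableaux of shape `kβ × N` on `2kβ` letters. -/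
def numRSSYT (N k β : ℕ) : ℕ :=
  Nat.card {T : SSYT (rect (k * β) N) (2 * (k * β)) // IsRestricted T}

end

end CUE

/-! Put `r = kβ`, `n = 2kβ` and `F(x) = E[det(A)⁻ʳ ∏_l det(1 - x_l A)]`, a symmetric polynomial in
`n` variables of degree at most `N` in each. All three claims rest on `F = (-1)^{Nr} s_{⟨N^r⟩}`
(`avgCharProd_eq_schurPoly`), valid whenever `r ≤ n`. The proof uses neither the Weyl integration
formula nor character orthogonality; it characterises `F` by differential equations.

Haar measure is invariant under `A ↦ exp(tX) A`, so derivatives along this flow have mean zero. The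
direction `X = 1` shows that `F` is homogeneous of degree `rN` (`sum_euler_avgCharProd`). A Casimir
sum over the matrix units gives a second-order equation (`integral_casimir`), which the resolvent
identity expresses through `F` alone (`eval_pde_avgCharProd`). After multiplication by the
Vandermonde polynomial `V` its singular terms cancel, and `V F` is an eigenvector of `∑_l (x_l
∂_l)²` (`sum_euler_euler_vand_mul`).

Both operators are diagonal on monomials. Hence an exponent vector of `V F` has prescribed sum and
sum of squares; antisymmetry makes its entries distinct, and they are less than `N + n`. The
complement in `{0, …, N+n-1}` is then the interval `[n-r, n-r+N)` (`exists_perm_of_sums`), so `V F`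
is a multiple of the alternant of the rectangle. The bialternant formula, which follows from
branching, identifies that alternant with `V` times the Schur polynomial, and one coefficient fixes
the constant.

On the unit circle the functional equation of the characteristic polynomial (`star_charP`) turns
`|P_N|^{2β}` into a phase times `P_N^{2β}`. Evaluating `F` gives the first claim. Circle averages
extract coefficients, so `Mom_N(k,β)` is, up to sign, a coefficient of `F` with its variables
identified in blocks, which counts restricted tableaux. Finally, all tableaux of shape `r × N` on
`2r` letters are encoded by `r²` numbers in `{0, …, N}`. -/

namespace CUE

noncomputable section

/-! ### The bialternant formula -/

/-- Column reduction of an alternant: splitting off the first variable. -/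
theorem det_pow_succ {R : Type*} [CommRing R] {n : ℕ} (z : Fin (n + 1) → R) (l : Fin (n + 1) → ℕ)
    (hl : ∀ j : Fin n, l j.castSucc ≤ l j.succ) :
    (Matrix.of fun i j => z i ^ l j).det =
      (∏ i : Fin n, (z i.succ - z 0)) *
        ∑ m ∈ Fintype.piFinset (fun j : Fin n => Finset.Ico (l j.castSucc) (l j.succ)),
          (Matrix.of fun i j : Fin n => z i.succ ^ m j).det *
            z 0 ^ (l 0 + ∑ j, (l j.succ - 1 - m j)) := by
  -- Subtracting from each column the right power of `z 0` times its predecessor clears the first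
  -- row except for its first entry.
  let B : Matrix (Fin (n + 1)) (Fin (n + 1)) R := Matrix.of fun i => Fin.cons (z i ^ l 0)
    fun j : Fin n => z i ^ l j.succ - z 0 ^ (l j.succ - l j.castSucc) * z i ^ l j.castSucc
  have hB : (Matrix.of fun i j => z i ^ l j).det = B.det := by
    refine Matrix.det_eq_of_forall_col_eq_smul_add_pred
      (fun j : Fin n => z 0 ^ (l j.succ - l j.castSucc)) ?_ ?_
    · intro i; simp [B]
    · intro i j; simp [B]
  have hB0 : ∀ j : Fin n, B 0 j.succ = 0 := by
    intro j
    simp only [B, Matrix.of_apply, Fin.cons_succ]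
    rw [← pow_add, Nat.sub_add_cancel (hl j), sub_self]
  have hBs : B.submatrix Fin.succ Fin.succ = Matrix.of fun i j : Fin n =>
      (z i.succ - z 0) * (Matrix.of fun i j : Fin n =>
        ∑ m ∈ Finset.Ico (l j.castSucc) (l j.succ), z 0 ^ (l j.succ - 1 - m) * z i.succ ^ m) i j := by
    ext i j
    simp only [B, Matrix.submatrix_apply, Matrix.of_apply, Fin.cons_succ]
    have key : ∀ a k : ℕ, ∀ x y : R, x ^ (a + k) - y ^ k * x ^ a =
        (x - y) * ∑ m ∈ Finset.Ico a (a + k), y ^ (a + k - 1 - m) * x ^ m := by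
      intro a k x y
      rw [Finset.sum_Ico_eq_sum_range]
      have h := (Commute.all x y).mul_geom_sum₂ k
      have h2 : ∑ i ∈ Finset.range (a + k - a), y ^ (a + k - 1 - (a + i)) * x ^ (a + i)
          = x ^ a * ∑ i ∈ Finset.range k, x ^ i * y ^ (k - 1 - i) := by
        rw [Finset.mul_sum, Nat.add_sub_cancel_left]
        refine Finset.sum_congr rfl fun i hi => ?_
        have : a + k - 1 - (a + i) = k - 1 - i := by omega
        rw [this, pow_add]; ring
      rw [h2, mul_left_comm, h, pow_add]; ring
    obtain ⟨k, hk⟩ := Nat.exists_eq_add_of_le (hl j)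
    rw [hk, ← key, Nat.add_sub_cancel_left]
  rw [hB, Matrix.det_succ_row_zero, Fin.sum_univ_succ]
  simp only [hB0, mul_zero, zero_mul, Finset.sum_const_zero, add_zero, Fin.val_zero, pow_zero,
    one_mul, Fin.succAbove_zero]
  have hB00 : B 0 0 = z 0 ^ l 0 := by simp [B]
  rw [hB00, hBs, Matrix.det_mul_column, ← Matrix.det_transpose]
  have hsum : (Matrix.of fun i j : Fin n =>
        ∑ m ∈ Finset.Ico (l j.castSucc) (l j.succ), z 0 ^ (l j.succ - 1 - m) * z i.succ ^ m).transpose =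
      fun j => ∑ m ∈ Finset.Ico (l j.castSucc) (l j.succ),
        (z 0 ^ (l j.succ - 1 - m) • fun i : Fin n => z i.succ ^ m) := by
    ext j i
    simp [Finset.sum_apply]
  -- Each column of the minor is now a geometric sum; multilinearity chooses one exponent `m j` from
  -- each. These choices are the interlacing conditions of the branching rule.
  have hml := (Matrix.detRowAlternating (n := Fin n) (R := R)).toMultilinearMap.map_sum_finset
    (fun j m => (z 0 ^ (l j.succ - 1 - m) • fun i : Fin n => z i.succ ^ m))
    (fun j : Fin n => Finset.Ico (l j.castSucc) (l j.succ))
  simp only [AlternatingMap.coe_multilinearMap] at hml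
  rw [hsum]
  change _ * (_ * Matrix.detRowAlternating _) = _
  rw [hml, mul_left_comm, Finset.mul_sum]
  congr 1
  refine Finset.sum_congr rfl fun m _ => ?_
  have := (Matrix.detRowAlternating (n := Fin n) (R := R)).toMultilinearMap.map_smul_univ
    (fun j => z 0 ^ (l j.succ - 1 - m j)) (fun j => fun i : Fin n => z i.succ ^ m j)
  simp only [AlternatingMap.coe_multilinearMap] at this
  rw [this, Finset.prod_pow_eq_pow_sum, smul_eq_mul, ← mul_assoc, ← pow_add, mul_comm,
    ← Matrix.det_transpose]
  rfl

/-! ### Branching of semistandard tableaux -/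

/-- The cells `(i, j)` of `Y` with `j < g i'` for all `i' ≤ i`. -/
def cut (Y : YoungDiagram) (g : ℕ → ℕ) : YoungDiagram where
  cells := {c ∈ Y.cells | ∀ i ≤ c.1, c.2 < g i}
  isLowerSet := by
    intro a b hab ha
    simp only [Finset.coe_filter, Set.mem_ofPred_eq] at ha ⊢
    exact ⟨Y.isLowerSet hab ha.1, fun i hi => lt_of_le_of_lt hab.2 (ha.2 i (hi.trans hab.1))⟩

theorem mem_cut {Y : YoungDiagram} {g : ℕ → ℕ} {i j : ℕ} :
    (i, j) ∈ cut Y g ↔ (i, j) ∈ Y ∧ ∀ i' ≤ i, j < g i' := by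
  rw [← YoungDiagram.mem_cells, cut, Finset.mem_filter, YoungDiagram.mem_cells]

theorem diagram_ext_rowLen {Y Z : YoungDiagram} (h : ∀ i, Y.rowLen i = Z.rowLen i) : Y = Z := by
  refine YoungDiagram.ext (Finset.ext fun ⟨i, j⟩ => ?_)
  rw [YoungDiagram.mem_cells, YoungDiagram.mem_cells, YoungDiagram.mem_iff_lt_rowLen,
    YoungDiagram.mem_iff_lt_rowLen, h]

theorem rowLen_eq_of_mem_iff {Y : YoungDiagram} {i a : ℕ} (h : ∀ j, (i, j) ∈ Y ↔ j < a) :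
    Y.rowLen i = a := by
  simp only [YoungDiagram.mem_iff_lt_rowLen] at h
  exact le_antisymm (not_lt.1 fun hh => lt_irrefl _ ((h a).1 hh))
    (not_lt.1 fun hh => lt_irrefl _ ((h _).2 hh))

theorem rowLen_cut {Y : YoungDiagram} {g : ℕ → ℕ} (hg : ∀ i, g (i + 1) ≤ g i)
    (hY : ∀ i, g i ≤ Y.rowLen i) (i : ℕ) : (cut Y g).rowLen i = g i := by
  refine rowLen_eq_of_mem_iff fun j => ?_
  rw [mem_cut, YoungDiagram.mem_iff_lt_rowLen]
  exact ⟨fun h => h.2 i le_rfl, fun h => ⟨h.trans_le (hY i),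
    fun i' hi' => h.trans_le (antitone_nat_of_succ_le hg hi')⟩⟩

theorem card_cells_eq_sum (Y : YoungDiagram) {n : ℕ} (h : Y.rowLen n = 0) :
    Y.cells.card = ∑ i : Fin n, Y.rowLen i := by
  have : Y.cells = (Finset.range n).biUnion fun i => Y.row i := by
    ext ⟨i, j⟩
    simp only [YoungDiagram.mem_cells, Finset.mem_biUnion, Finset.mem_range,
      YoungDiagram.mem_row_iff]
    constructor
    · intro hc
      refine ⟨i, not_le.1 fun hi => ?_, hc, rfl⟩
      have := Y.rowLen_anti n i hi
      rw [YoungDiagram.mem_iff_lt_rowLen] at hc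
      omega
    · rintro ⟨_, _, hc, _⟩; exact hc
  rw [this, Finset.card_biUnion, Finset.sum_range]
  · simp [YoungDiagram.rowLen_eq_card]
  · intro i _ i' _ hii
    rw [Function.onFun, Finset.disjoint_left]
    intro c h1 h2
    exact hii ((YoungDiagram.mem_row_iff.1 h1).2.symm.trans (YoungDiagram.mem_row_iff.1 h2).2)

/-- The cells of a tableau whose entries are less than `n`. -/
def lowShape {Y : YoungDiagram} (T : SemistandardYoungTableau Y) (n : ℕ) : YoungDiagram where
  cells := {c ∈ Y.cells | T c.1 c.2 < n}
  isLowerSet := by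
    intro a b hab ha
    simp only [Finset.coe_filter, Set.mem_ofPred_eq, YoungDiagram.mem_cells] at ha ⊢
    have hb : b ∈ Y := Y.isLowerSet hab ha.1
    have h1 : (b.1, a.2) ∈ Y := Y.up_left_mem hab.1 le_rfl ha.1
    exact ⟨hb, ((T.row_weak_of_le hab.2 h1).trans (T.col_weak hab.1 ha.1)).trans_lt ha.2⟩

theorem mem_lowShape {Y : YoungDiagram} {T : SemistandardYoungTableau Y} {n i j : ℕ} :
    (i, j) ∈ lowShape T n ↔ (i, j) ∈ Y ∧ T i j < n := by
  rw [← YoungDiagram.mem_cells, lowShape, Finset.mem_filter, YoungDiagram.mem_cells]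

theorem SSYT.lt {Y : YoungDiagram} {n : ℕ} (T : SSYT Y n) {i j : ℕ} (h : (i, j) ∈ Y) :
    T.1 i j < n :=
  T.2 (i, j) h

theorem le_entry {Y : YoungDiagram} (T : SemistandardYoungTableau Y) {i j : ℕ} (h : (i, j) ∈ Y) :
    i ≤ T i j := by
  induction i with
  | zero => exact Nat.zero_le _
  | succ i ih =>
    have := ih (Y.up_left_mem (Nat.le_succ i) le_rfl h)
    have := T.col_strict (Nat.lt_add_one i) h
    omega

/-- Extension of a tableau of shape `Z` to `Y` by the letter `n`. -/
def extendBy {Y Z : YoungDiagram} {n : ℕ} (T : SSYT Z n)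
    (hv : ∀ i j, (i + 1, j) ∈ Y → (i, j) ∈ Z) : SemistandardYoungTableau Y where
  entry i j := if (i, j) ∈ Y then (if (i, j) ∈ Z then T.1 i j else n) else 0
  row_weak' {i j1 j2} hj h := by
    rw [if_pos h, if_pos (Y.up_left_mem le_rfl hj.le h)]
    by_cases h2 : (i, j2) ∈ Z
    · rw [if_pos h2, if_pos (Z.up_left_mem le_rfl hj.le h2)]
      exact T.1.row_weak hj h2
    · rw [if_neg h2]
      split_ifs with h1
      · exact (T.lt h1).le
      · exact le_rfl
  col_strict' {i1 i2 j} hi h := by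
    -- By `hv` the skew shape `Y / Z` is a horizontal strip, so the new letter occurs at most once
    -- in each column.
    have h1 : (i1, j) ∈ Z := by
      obtain ⟨i, rfl⟩ : ∃ i, i2 = i + 1 := ⟨i2 - 1, by omega⟩
      exact Z.up_left_mem (by omega) le_rfl (hv i j h)
    rw [if_pos h, if_pos (Y.up_left_mem hi.le le_rfl h), if_pos h1]
    split_ifs with h2
    · exact T.1.col_strict hi h2
    · exact T.lt h1
  zeros' h := if_neg h

theorem extendBy_apply {Y Z : YoungDiagram} {n : ℕ} (T : SSYT Z n)
    (hv : ∀ i j, (i + 1, j) ∈ Y → (i, j) ∈ Z) (i j : ℕ) :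
    extendBy T hv i j = if (i, j) ∈ Y then (if (i, j) ∈ Z then T.1 i j else n) else 0 := rfl

theorem content_last {Y : YoungDiagram} {n : ℕ} (T : SSYT Y (n + 1)) :
    T.content n = Y.cells.card - (lowShape T.1 n).cells.card := by
  have : (lowShape T.1 n).cells.card + T.content n = Y.cells.card := by
    rw [SSYT.content, ← Finset.card_filter_add_card_filter_not (s := Y.cells)
      (fun c => T.1 c.1 c.2 < n)]
    congr 2
    refine Finset.filter_congr fun c hc => ?_
    have := T.2 c hc
    omega
  omega

/-- The generating function of the tableaux of shape `Y`; the letter `i` is weighted by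
`z (rev i)`. -/
def tabSum {R : Type*} [CommRing R] (Y : YoungDiagram) {n : ℕ} (z : Fin n → R) : R :=
  ∑ T : SSYT Y n, ∏ i : Fin n, z i.rev ^ T.content i

/-- Deleting the largest letter and filling the strip `Y / Z` with it are mutually inverse. That
letter carries the weight `z 0`, the variable split off by `det_pow_succ`; this is the purpose of
the reversal in `tabSum`. -/
theorem sum_fiber_lowShape {R : Type*} [CommRing R] {Y Z : YoungDiagram} {n : ℕ}
    (hZY : Z ≤ Y) (hv : ∀ i j, (i + 1, j) ∈ Y → (i, j) ∈ Z) (z : Fin (n + 1) → R)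
    (S : Finset (SSYT Y (n + 1))) (hS : ∀ T, T ∈ S ↔ lowShape T.1 n = Z) :
    ∑ T ∈ S, ∏ i : Fin (n + 1), z i.rev ^ T.content i =
      tabSum Z (fun i : Fin n => z i.succ) * z 0 ^ (Y.cells.card - Z.cells.card) := by
  rw [tabSum, Finset.sum_mul]
  have hext : ∀ T : SSYT Z n, lowShape (extendBy T hv) n = Z := by
    intro T
    refine YoungDiagram.ext (Finset.ext fun ⟨i, j⟩ => ?_)
    rw [YoungDiagram.mem_cells, YoungDiagram.mem_cells, mem_lowShape, extendBy_apply]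
    constructor
    · rintro ⟨h1, h2⟩
      rw [if_pos h1] at h2
      by_contra h
      rw [if_neg h] at h2
      exact lt_irrefl _ h2
    · intro h
      have hY : (i, j) ∈ Y := hZY h
      rw [if_pos hY, if_pos h]
      exact ⟨hY, T.lt h⟩
  refine Finset.sum_bij'
    (i := fun T hT => (⟨⟨fun i j => if (i, j) ∈ Z then T.1 i j else 0, ?_, ?_, ?_⟩, ?_⟩ : SSYT Z n))
    (j := fun T _ => (⟨extendBy T hv, ?_⟩ : SSYT Y (n + 1))) ?_ ?_ ?_ ?_ ?_
  · intro i j1 j2 hj h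
    rw [if_pos h, if_pos (Z.up_left_mem le_rfl hj.le h)]
    exact T.1.row_weak hj (hZY h)
  · intro i1 i2 j hi h
    rw [if_pos h, if_pos (Z.up_left_mem hi.le le_rfl h)]
    exact T.1.col_strict hi (hZY h)
  · intro i j h
    exact if_neg h
  · intro c hc
    change (if (c.1, c.2) ∈ Z then T.1 c.1 c.2 else 0) < n
    rw [YoungDiagram.mem_cells] at hc
    rw [if_pos hc]
    have := (hS T).1 hT
    rw [← this] at hc
    exact (mem_lowShape.1 hc).2
  · intro c hc
    change (if (c.1, c.2) ∈ Y then (if (c.1, c.2) ∈ Z then T.1 c.1 c.2 else n) else 0) < n + 1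
    rw [YoungDiagram.mem_cells] at hc
    rw [if_pos hc]
    split_ifs with h
    · exact (T.lt h).trans (Nat.lt_add_one n)
    · exact Nat.lt_add_one n
  · intro T hT; exact Finset.mem_univ _
  · intro T _
    exact (hS _).2 (hext T)
  · intro T hT
    have hT' := (hS T).1 hT
    refine Subtype.ext (SemistandardYoungTableau.ext fun i j => ?_)
    change (if (i, j) ∈ Y then (if (i, j) ∈ Z then (if (i, j) ∈ Z then T.1 i j else 0) else n) else 0) = T.1 i j
    by_cases hY : (i, j) ∈ Y
    · rw [if_pos hY]
      by_cases hZ : (i, j) ∈ Z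
      · rw [if_pos hZ, if_pos hZ]
      · rw [if_neg hZ]
        rw [← hT', mem_lowShape] at hZ
        have := T.lt hY
        have : ¬ T.1 i j < n := fun h => hZ ⟨hY, h⟩
        omega
    · rw [if_neg hY, T.1.zeros hY]
  · intro T _
    refine Subtype.ext (SemistandardYoungTableau.ext fun i j => ?_)
    change (if (i, j) ∈ Z then (if (i, j) ∈ Y then (if (i, j) ∈ Z then T.1 i j else n) else 0) else 0) = T.1 i j
    by_cases hZ : (i, j) ∈ Z
    · rw [if_pos hZ, if_pos (hZY hZ), if_pos hZ]
    · rw [if_neg hZ, T.1.zeros hZ]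
  · intro T hT
    have hT' := (hS T).1 hT
    rw [Fin.prod_univ_castSucc]
    congr 1
    · refine Finset.prod_congr rfl fun i _ => ?_
      rw [Fin.rev_castSucc]
      congr 1
      simp only [SSYT.content, Fin.val_castSucc]
      congr 1
      ext ⟨a, b⟩
      simp only [Finset.mem_filter, YoungDiagram.mem_cells]
      change _ ↔ (a, b) ∈ Z ∧ (if (a, b) ∈ Z then T.1 a b else 0) = i
      constructor
      · rintro ⟨h1, h2⟩
        have : (a, b) ∈ Z := by
          rw [← hT', mem_lowShape, h2]; exact ⟨h1, i.2⟩
        rw [if_pos this]; exact ⟨this, h2⟩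
      · rintro ⟨h1, h2⟩
        rw [if_pos h1] at h2
        exact ⟨hZY h1, h2⟩
    · rw [Fin.rev_last, Fin.val_last, content_last, hT']

/-- The function on `ℕ` that continues `μ` by zero. -/
def extZero {n : ℕ} (μ : Fin n → ℕ) (i : ℕ) : ℕ := if h : i < n then μ ⟨i, h⟩ else 0

theorem extZero_val {n : ℕ} (μ : Fin n → ℕ) (i : Fin n) : extZero μ i = μ i := by
  simp [extZero]

/-- The branching rule. A cell with a cell of `Y` below it holds a letter less than `n`, by column
strictness. So the shape left after removing the letter `n` has rows interlacing those of `Y`, and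
by `le_entry` it has at most `n` rows. -/
theorem tabSum_succ {R : Type*} [CommRing R] {Y : YoungDiagram} {n : ℕ}
    (hY : Y.rowLen (n + 1) = 0) (z : Fin (n + 1) → R) :
    tabSum Y z = ∑ μ ∈ Fintype.piFinset
        (fun j : Fin n => Finset.Icc (Y.rowLen (j + 1)) (Y.rowLen j)),
      tabSum (cut Y (extZero μ)) (fun i : Fin n => z i.succ) *
        z 0 ^ (Y.cells.card - (cut Y (extZero μ)).cells.card) := by
  have hrow : ∀ T : SSYT Y (n + 1), ∀ i j, (i + 1, j) ∈ Y → (i, j) ∈ lowShape T.1 n := by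
    intro T i j h
    have h1 := T.1.col_strict (Nat.lt_add_one i) h
    have h2 := T.lt h
    exact mem_lowShape.2 ⟨Y.up_left_mem (Nat.le_succ i) le_rfl h, by omega⟩
  have hle : ∀ T : SSYT Y (n + 1), ∀ i, (lowShape T.1 n).rowLen i ≤ Y.rowLen i := by
    intro T i
    refine not_lt.1 fun h => ?_
    have := (mem_lowShape.1 (YoungDiagram.mem_iff_lt_rowLen.2 h)).1
    rw [YoungDiagram.mem_iff_lt_rowLen] at this
    exact lt_irrefl _ this
  rw [tabSum, ← Finset.sum_fiberwise_of_maps_to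
    (g := fun (T : SSYT Y (n + 1)) (j : Fin n) => (lowShape T.1 n).rowLen j)
    (t := Fintype.piFinset (fun j : Fin n => Finset.Icc (Y.rowLen (j + 1)) (Y.rowLen j)))]
  · refine Finset.sum_congr rfl fun μ hμ => ?_
    rw [Fintype.mem_piFinset] at hμ
    simp only [Finset.mem_Icc] at hμ
    have hg1 : ∀ i, extZero μ i ≤ Y.rowLen i := by
      intro i
      unfold extZero
      split_ifs with h
      · exact (hμ ⟨i, h⟩).2
      · exact Nat.zero_le _
    have hg0 : ∀ i, Y.rowLen (i + 1) ≤ extZero μ i := by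
      intro i
      unfold extZero
      split_ifs with h
      · exact (hμ ⟨i, h⟩).1
      · have := Y.rowLen_anti (n + 1) (i + 1) (by omega)
        omega
    have hg : ∀ i, extZero μ (i + 1) ≤ extZero μ i := fun i => (hg1 _).trans (hg0 i)
    have hcut := rowLen_cut hg hg1
    refine sum_fiber_lowShape ?_ ?_ z _ ?_
    · rintro ⟨i, j⟩ h
      exact (mem_cut.1 h).1
    · intro i j h
      rw [YoungDiagram.mem_iff_lt_rowLen] at h ⊢
      rw [hcut]
      exact h.trans_le (hg0 i)
    · intro T
      simp only [Finset.mem_filter, Finset.mem_univ, true_and]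
      constructor
      · intro h
        refine diagram_ext_rowLen fun i => ?_
        rw [hcut]
        by_cases hi : i < n
        · rw [extZero, dif_pos hi, ← h]
        · rw [extZero, dif_neg hi]
          refine rowLen_eq_of_mem_iff fun j => ?_
          rw [mem_lowShape]
          refine ⟨fun hc => ?_, fun hc => absurd hc (Nat.not_lt_zero _)⟩
          have := le_entry T.1 hc.1
          omega
      · intro h
        funext j
        rw [h, hcut, extZero_val]
  · intro T _
    rw [Fintype.mem_piFinset]
    intro j
    rw [Finset.mem_Icc]
    refine ⟨not_lt.1 fun h => ?_, hle T j⟩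
    have := hrow T j _ (YoungDiagram.mem_iff_lt_rowLen.2 h)
    rw [YoungDiagram.mem_iff_lt_rowLen] at this
    exact lt_irrefl _ this

/-- Induction on the number of variables: `det_pow_succ` and `tabSum_succ` are the same recursion.
Indices are reversed because the exponents increase along the columns while the rows of a diagram
decrease. No division occurs, so any commutative ring is allowed. -/
theorem bialternant {R : Type*} [CommRing R] {n : ℕ} (Y : YoungDiagram) (hY : Y.rowLen n = 0)
    (z : Fin n → R) :
    (Matrix.of fun i j : Fin n => z i ^ (Y.rowLen j.rev + j)).det =
      (Matrix.vandermonde z).det * tabSum Y z := by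
  induction n generalizing Y with
  | zero =>
    have hempty : ∀ i j, (i, j) ∉ Y := by
      intro i j h
      have := Y.rowLen_anti 0 i (Nat.zero_le _)
      rw [YoungDiagram.mem_iff_lt_rowLen] at h
      omega
    have : Unique (SSYT Y 0) :=
      { default := ⟨SemistandardYoungTableau.highestWeight Y, fun c hc => absurd hc (hempty c.1 c.2)⟩
        uniq := fun T => Subtype.ext (SemistandardYoungTableau.ext fun i j => by
          rw [T.1.zeros (hempty i j), SemistandardYoungTableau.zeros _ (hempty i j)]) }
    rw [tabSum, Fintype.sum_unique (ι := SSYT Y 0)]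
    simp
  | succ n ih =>
    have hV : (Matrix.vandermonde z).det =
        (∏ i : Fin n, (z i.succ - z 0)) * (Matrix.vandermonde fun i : Fin n => z i.succ).det := by
      simp [Matrix.det_vandermonde, Fin.prod_univ_succ, Fin.prod_Ioi_succ]
    rw [det_pow_succ, tabSum_succ hY, hV, mul_assoc]
    · congr 1
      rw [Finset.mul_sum]
      -- Adding the staircase turns weak interlacing of partitions into the half-open ranges of the
      -- column exponents.
      refine Finset.sum_bij' (i := fun (m : Fin n → ℕ) _ (j : Fin n) => m j.rev - (j.rev : ℕ))
        (j := fun (μ : Fin n → ℕ) _ (j : Fin n) => μ j.rev + j) ?_ ?_ ?_ ?_ ?_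
      · intro m hm
        rw [Fintype.mem_piFinset] at hm ⊢
        intro j
        have := hm j.rev
        simp only [Finset.mem_Ico, Finset.mem_Icc, Fin.rev_castSucc, Fin.rev_succ, Fin.rev_rev,
          Fin.val_succ, Fin.val_castSucc] at this ⊢
        omega
      · intro μ hμ
        rw [Fintype.mem_piFinset] at hμ ⊢
        intro j
        have := hμ j.rev
        simp only [Finset.mem_Ico, Finset.mem_Icc, Fin.rev_castSucc, Fin.rev_succ,
          Fin.val_succ, Fin.val_castSucc] at this ⊢
        omega
      · intro m hm
        rw [Fintype.mem_piFinset] at hm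
        funext j
        have := hm j
        simp only [Finset.mem_Ico, Fin.rev_castSucc, Fin.rev_succ,
          Fin.val_succ, Fin.val_castSucc] at this
        simp only [Fin.rev_rev]
        omega
      · intro μ _
        funext j
        simp
      · intro m hm
        rw [Fintype.mem_piFinset] at hm
        simp only [Finset.mem_Ico, Fin.rev_castSucc, Fin.rev_succ,
          Fin.val_succ, Fin.val_castSucc] at hm
        set μ : Fin n → ℕ := fun j => m j.rev - (j.rev : ℕ) with hμdef
        have hm' : ∀ j, m j = μ j.rev + j := by
          intro j
          have := hm j
          simp only [hμdef, Fin.rev_rev]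
          omega
        have hμ : ∀ j : Fin n, Y.rowLen (j + 1) ≤ μ j ∧ μ j ≤ Y.rowLen j := by
          intro j
          have h1 := hm j.rev
          have h2 := hm' j.rev
          simp only [Fin.rev_rev] at h1 h2
          omega
        have hg1 : ∀ i, extZero μ i ≤ Y.rowLen i := by
          intro i
          unfold extZero
          split_ifs with h
          · exact (hμ ⟨i, h⟩).2
          · exact Nat.zero_le _
        have hg : ∀ i, extZero μ (i + 1) ≤ extZero μ i := by
          intro i
          by_cases h : i < n
          · refine (hg1 _).trans ?_
            rw [extZero, dif_pos h]
            exact (hμ ⟨i, h⟩).1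
          · rw [extZero, dif_neg (by omega)]
            exact Nat.zero_le _
        have hcut := rowLen_cut hg hg1
        have hcn : (cut Y (extZero μ)).rowLen n = 0 := by
          rw [hcut, extZero, dif_neg (lt_irrefl n)]
        have hdet := ih (cut Y (extZero μ)) hcn (fun i => z i.succ)
        rw [← mul_assoc, ← hdet]
        -- The exponent of `z 0` is the size of the removed strip: the whole bottom row of `Y`
        -- together with the row differences.
        have hcard : Y.cells.card - (cut Y (extZero μ)).cells.card =
            Y.rowLen ((0 : Fin (n + 1)).rev) + ((0 : Fin (n + 1)) : ℕ) +
              ∑ j : Fin n, (Y.rowLen (j.succ.rev) + (j.succ : ℕ) - 1 - m j) := by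
          have h1 : ∀ j : Fin n, Y.rowLen (j.succ.rev) + (j.succ : ℕ) - 1 - m j =
              Y.rowLen j.rev - μ j.rev := by
            intro j
            rw [hm' j, Fin.rev_succ, Fin.val_succ, Fin.val_castSucc]
            omega
          have h0 : ∑ j : Fin n, (Y.rowLen j.rev - μ j.rev) = ∑ j : Fin n, (Y.rowLen j - μ j) :=
            Equiv.sum_comp Fin.revPerm (fun j : Fin n => Y.rowLen j - μ j)
          rw [Finset.sum_congr rfl fun j _ => h1 j, h0,
            card_cells_eq_sum _ hY, card_cells_eq_sum _ hcn, Fin.sum_univ_castSucc,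
            Finset.sum_tsub_distrib _ fun j _ => (hμ j).2]
          have h2 : ∑ i : Fin n, (cut Y (extZero μ)).rowLen i = ∑ i, μ i :=
            Finset.sum_congr rfl fun i _ => by rw [hcut, extZero_val]
          have h3 : ∑ i, μ i ≤ ∑ i : Fin n, Y.rowLen i :=
            Finset.sum_le_sum fun i _ => (hμ i).2
          rw [h2]
          simp only [Fin.val_castSucc, Fin.val_last, Fin.rev_zero, Fin.val_zero]
          omega
        rw [hcard]
        congr 2
        refine congrArg Matrix.of ?_
        funext i j
        rw [hcut, extZero_val, ← hm']
    · intro j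
      have := Y.rowLen_anti j.succ.rev j.castSucc.rev (by
        simp only [Fin.rev_castSucc, Fin.rev_succ, Fin.val_succ, Fin.val_castSucc]; omega)
      simp only [Fin.val_succ, Fin.val_castSucc]
      omega

/-! ### Tableaux of rectangular shape -/

theorem mem_rect {r c i j : ℕ} : (i, j) ∈ rect r c ↔ i < r ∧ j < c := by
  rw [← YoungDiagram.mem_cells, rect, Finset.mem_product, Finset.mem_range, Finset.mem_range]

theorem rowLen_rect (r c i : ℕ) : (rect r c).rowLen i = if i < r then c else 0 := by
  refine rowLen_eq_of_mem_iff fun j => ?_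
  rw [mem_rect]
  split_ifs with h <;> simp [h]

/-- Every column has full height `r`, so below an entry in row `i` there are `r - 1 - i` strictly
larger ones, all less than `n`. -/
theorem entry_le_of_rect {r c n : ℕ} (T : SemistandardYoungTableau (rect r c))
    (hT : ∀ i j, (i, j) ∈ rect r c → T i j < n) {i j : ℕ} (h : (i, j) ∈ rect r c) :
    T i j + r ≤ n + i := by
  obtain ⟨hi, hj⟩ := mem_rect.1 h
  have key : ∀ d i, i + d + 1 = r → T i j + r ≤ n + i := by
    intro d
    induction d with
    | zero =>
      intro i hi
      have := hT i j (mem_rect.2 ⟨by omega, hj⟩)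
      omega
    | succ d ih =>
      intro i hi
      have h1 := ih (i + 1) (by omega)
      have h2 := T.col_strict (Nat.lt_add_one i) (mem_rect.2 ⟨by omega, hj⟩)
      omega
  exact key (r - 1 - i) i (by omega)

/-- With `2r` letters the entries of row `i` lie between `i` and `i + r`. Being weakly increasing,
the row is determined by `r` numbers: how many of its entries are at most `i + t`, for `t < r`. -/
theorem card_SSYT_rect_le (r N : ℕ) :
    Nat.card (SSYT (rect r N) (2 * r)) ≤ (N + 1) ^ (r ^ 2) := by
  have hlen : ∀ (T : SSYT (rect r N) (2 * r)) (m i : ℕ), (lowShape T.1 m).rowLen i ≤ N := by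
    intro T m i
    refine not_lt.1 fun h => ?_
    have := (mem_rect.1 (mem_lowShape.1 (YoungDiagram.mem_iff_lt_rowLen.2 h)).1).2
    exact lt_irrefl _ this
  let f : SSYT (rect r N) (2 * r) → (Fin r × Fin r → Fin (N + 1)) := fun T p =>
    ⟨(lowShape T.1 (p.1 + p.2 + 1)).rowLen p.1, Nat.lt_succ_of_le (hlen T _ _)⟩
  have hle : ∀ S T : SSYT (rect r N) (2 * r), f S = f T → ∀ i j, (i, j) ∈ rect r N →
      S.1 i j ≤ T.1 i j := by
    intro S T hST i j hij
    have h1 := le_entry T.1 hij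
    have h2 := entry_le_of_rect S.1 (fun _ _ h => S.lt h) hij
    by_contra! hlt
    -- The smaller of the two entries is strictly below the maximum `i + r`, so it is one of the
    -- recorded thresholds, and it separates the tableaux.
    have ht : T.1 i j - i < r := by omega
    have h3 := congrArg Fin.val (congrFun hST (⟨i, (mem_rect.1 hij).1⟩, ⟨T.1 i j - i, ht⟩))
    simp only [f] at h3
    have h4 : (i, j) ∈ lowShape T.1 (i + (T.1 i j - i) + 1) :=
      mem_lowShape.2 ⟨hij, by omega⟩
    rw [YoungDiagram.mem_iff_lt_rowLen, ← h3, ← YoungDiagram.mem_iff_lt_rowLen, mem_lowShape] at h4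
    omega
  have hinj : Function.Injective f := by
    intro S T hST
    refine Subtype.ext (SemistandardYoungTableau.ext fun i j => ?_)
    by_cases hij : (i, j) ∈ rect r N
    · exact le_antisymm (hle S T hST i j hij) (hle T S hST.symm i j hij)
    · rw [S.1.zeros hij, T.1.zeros hij]
  refine (Nat.card_le_card_of_injective f hinj).trans ?_
  rw [Nat.card_eq_fintype_card, Fintype.card_fun, Fintype.card_prod, Fintype.card_fin,
    Fintype.card_fin, pow_two]

/-- If only letters below `r` occur, the lower and upper bounds on an entry in row `i` both equal
`i`. This normalises the Schur polynomial by a coefficient equal to one. -/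
theorem existsUnique_content_rect {r N n : ℕ} (hr : r ≤ n) :
    ∃! T : SSYT (rect r N) n, ∀ i : Fin n, T.content i = if (i : ℕ) < r then N else 0 := by
  refine ⟨⟨SemistandardYoungTableau.highestWeight _, ?_⟩, ?_, ?_⟩
  · rintro ⟨i, j⟩ hc
    rw [YoungDiagram.mem_cells] at hc
    rw [SemistandardYoungTableau.highestWeight_apply, if_pos hc]
    exact (mem_rect.1 hc).1.trans_le hr
  · intro i
    have : ((rect r N).cells.filter fun c : ℕ × ℕ =>
        SemistandardYoungTableau.highestWeight (rect r N) c.1 c.2 = i) =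
        if (i : ℕ) < r then {(i : ℕ)} ×ˢ Finset.range N else ∅ := by
      ext ⟨a, b⟩
      rw [Finset.mem_filter, YoungDiagram.mem_cells, mem_rect,
        SemistandardYoungTableau.highestWeight_apply]
      simp only [mem_rect]
      split_ifs with h1 h2 h2 <;> simp <;> omega
    unfold SSYT.content
    refine (congrArg Finset.card this).trans ?_
    split_ifs <;> simp
  · intro T hT
    have hlt : ∀ i j, (i, j) ∈ rect r N → T.1 i j < r := by
      intro i j h
      by_contra hge
      have h1 := hT ⟨T.1 i j, T.lt h⟩
      simp only [hge, if_false] at h1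
      rw [SSYT.content, Finset.card_eq_zero] at h1
      have h2 : (i, j) ∈ (rect r N).cells.filter fun c : ℕ × ℕ => T.1 c.1 c.2 = T.1 i j :=
        Finset.mem_filter.2 ⟨h, rfl⟩
      rw [h1] at h2
      exact absurd h2 (Finset.notMem_empty _)
    refine Subtype.ext (SemistandardYoungTableau.ext fun i j => ?_)
    rw [SemistandardYoungTableau.highestWeight_apply]
    split_ifs with h
    · have h1 := entry_le_of_rect T.1 hlt h
      have h2 := le_entry T.1 h
      omega
    · exact T.1.zeros h

section Flow

/-! ### Integration over `U(N)` -/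

instance (N : ℕ) : IsProbabilityMeasure (haarU N) :=
  ⟨by simpa [haarU] using Measure.haarMeasure_self (K₀ := (⊤ : TopologicalSpace.PositiveCompacts (U N)))⟩

instance (N : ℕ) : (haarU N).IsMulLeftInvariant := by unfold haarU; infer_instance

theorem integrable_haarU {N : ℕ} {E : Type*} [NormedAddCommGroup E] {f : U N → E}
    (hf : Continuous f) : Integrable f (haarU N) :=
  hf.integrable_of_hasCompactSupport (HasCompactSupport.of_compactSpace f)

open scoped Matrix.Norms.L2Operator

/-- The unitary `exp (t X)` for skew-Hermitian `X`. -/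
def expU {N : ℕ} (X : Matrix (Fin N) (Fin N) ℂ) (hX : X ∈ skewAdjoint (Matrix (Fin N) (Fin N) ℂ))
    (t : ℝ) : U N :=
  ⟨NormedSpace.exp ((t : ℂ) • X), by
    let : NormedAlgebra ℚ (Matrix (Fin N) (Fin N) ℂ) := NormedAlgebra.restrictScalars ℚ ℂ _
    refine NormedSpace.exp_mem_unitary_of_mem_skewAdjoint ?_
    rw [skewAdjoint.mem_iff] at hX ⊢
    rw [star_smul, hX, smul_neg, RCLike.star_def, Complex.conj_ofReal]⟩

theorem expU_add {N : ℕ} {X : Matrix (Fin N) (Fin N) ℂ}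
    (hX : X ∈ skewAdjoint (Matrix (Fin N) (Fin N) ℂ)) (s t : ℝ) :
    expU X hX (s + t) = expU X hX s * expU X hX t := by
  refine Subtype.ext ?_
  change NormedSpace.exp (((s + t : ℝ) : ℂ) • X) =
    NormedSpace.exp ((s : ℂ) • X) * NormedSpace.exp ((t : ℂ) • X)
  rw [Complex.ofReal_add, add_smul]
  exact Matrix.exp_add_of_commute _ _ (((Commute.refl X).smul_left _).smul_right _)

theorem expU_zero {N : ℕ} {X : Matrix (Fin N) (Fin N) ℂ}
    (hX : X ∈ skewAdjoint (Matrix (Fin N) (Fin N) ℂ)) : expU X hX 0 = 1 := by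
  refine Subtype.ext ?_
  change NormedSpace.exp (((0 : ℝ) : ℂ) • X) = 1
  rw [Complex.ofReal_zero, zero_smul, NormedSpace.exp_zero]

/-- The derivative of a function along a left translation flow has integral zero. -/
theorem integral_flow_deriv_eq_zero {N : ℕ} {X : Matrix (Fin N) (Fin N) ℂ}
    (hX : X ∈ skewAdjoint (Matrix (Fin N) (Fin N) ℂ)) {f : Matrix (Fin N) (Fin N) ℂ → ℂ}
    {g : U N → ℂ} (hf : Continuous fun A : U N => f A) (hg : Continuous g)
    (hd : ∀ A : U N, HasDerivAt (fun t : ℂ => f (NormedSpace.exp (t • X) * A)) (g A) 0) :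
    ∫ A, g A ∂(haarU N) = 0 := by
  have hder : ∀ (A : U N) (t : ℝ), HasDerivAt (fun s : ℝ => f (expU X hX s * A : U N))
      (g (expU X hX t * A)) t := by
    intro A t
    -- By the group law, the derivative at time `t` is the derivative at time zero from the base
    -- point `expU X hX t * A`.
    have h1 := (hd (expU X hX t * A)).comp_ofReal (z := 0)
    have h2 : HasDerivAt (fun s : ℝ => f (expU X hX s * (expU X hX t * A) : U N))
      (g (expU X hX t * A)) (t - t) := by
      rw [sub_self]; exact h1
    have h3 := h2.comp_sub_const t t
    refine h3.congr_of_eventuallyEq (Filter.Eventually.of_forall fun s => ?_)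
    simp only
    rw [← mul_assoc, ← expU_add, sub_add_cancel]
  obtain ⟨C, hC⟩ := (isCompact_univ (X := U N)).exists_bound_of_continuousOn hg.continuousOn
  have hmul : ∀ t, Continuous fun A : U N => expU X hX t * A := fun t => continuous_const.mul continuous_id
  have key := (hasDerivAt_integral_of_dominated_loc_of_deriv_le (μ := haarU N) (x₀ := (0 : ℝ))
    (s := Set.univ) (bound := fun _ => C)
    (F := fun t A => f (expU X hX t * A : U N)) (F' := fun t A => g (expU X hX t * A))
    Filter.univ_mem
    (Filter.Eventually.of_forall fun t => (integrable_haarU (hf.comp (hmul t))).1)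
    (integrable_haarU (hf.comp (hmul 0))) (integrable_haarU (hg.comp (hmul 0))).1
    (Filter.Eventually.of_forall fun A t _ => hC _ (Set.mem_univ _))
    (integrable_const C)
    (Filter.Eventually.of_forall fun A t _ => hder A t)).2
  have hconst : (fun t : ℝ => ∫ A, f (expU X hX t * A : U N) ∂(haarU N)) =
      fun _ => ∫ A : U N, f A ∂(haarU N) := by
    funext t
    exact integral_mul_left_eq_self (μ := haarU N) (fun A : U N => f A) (expU X hX t)
  rw [hconst] at key
  have h0 := key.unique (hasDerivAt_const (0 : ℝ) _)
  simpa [expU_zero] using h0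

/-- The infinitesimal invariance of the Haar measure, extended linearly to all matrices `X`. -/
theorem integral_deriv_eq_zero {N : ℕ} {f : Matrix (Fin N) (Fin N) ℂ → ℂ}
    (g : U N → Matrix (Fin N) (Fin N) ℂ →ₗ[ℂ] ℂ) (hf : Continuous fun A : U N => f A)
    (hg : ∀ X, Continuous fun A => g A X)
    (hd : ∀ (A : U N) X, HasDerivAt (fun t : ℂ => f (NormedSpace.exp (t • X) * A)) (g A X) 0)
    (X : Matrix (Fin N) (Fin N) ℂ) : ∫ A, g A X ∂(haarU N) = 0 := by
  have hskew : ∀ Y ∈ skewAdjoint (Matrix (Fin N) (Fin N) ℂ), ∫ A, g A Y ∂(haarU N) = 0 :=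
    fun Y hY => integral_flow_deriv_eq_zero hY hf (hg Y) fun A => hd A Y
  have h1 : X - star X ∈ skewAdjoint (Matrix (Fin N) (Fin N) ℂ) := by
    rw [skewAdjoint.mem_iff, star_sub, star_star, neg_sub]
  have h2 : Complex.I • (X + star X) ∈ skewAdjoint (Matrix (Fin N) (Fin N) ℂ) := by
    rw [skewAdjoint.mem_iff, star_smul, star_add, star_star, RCLike.star_def, Complex.conj_I,
      neg_smul, add_comm]
  -- Every matrix is a complex combination of two skew-Hermitian ones, and `g A` is complex linear.
  have hdec : ∀ A, g A X = (1 / 2 : ℂ) * g A (X - star X) +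
      (-Complex.I / 2) * g A (Complex.I • (X + star X)) := by
    intro A
    rw [map_smul, map_sub, map_add, smul_eq_mul]
    linear_combination ((g A X + g A (star X)) / 2) * Complex.I_sq
  simp only [hdec]
  rw [integral_add ((integrable_haarU (hg _)).const_mul _) ((integrable_haarU (hg _)).const_mul _),
    integral_const_mul, integral_const_mul, hskew _ h1, hskew _ h2, mul_zero, mul_zero, add_zero]

/-! ### Derivatives of determinants and inverses -/

/-- Logarithmic derivatives add. Writing each derivative as value times `c i` avoids any assumption
that the factors are nonzero. -/
theorem hasDerivAt_prod_log {ι : Type*} (s : Finset ι) {u : ι → ℂ → ℂ} {c : ι → ℂ} {t : ℂ}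
    (h : ∀ i ∈ s, HasDerivAt (u i) (u i t * c i) t) :
    HasDerivAt (fun x => ∏ i ∈ s, u i x) ((∏ i ∈ s, u i t) * ∑ i ∈ s, c i) t := by
  classical
  induction s using Finset.induction_on with
  | empty => simpa using hasDerivAt_const t (1 : ℂ)
  | insert a s ha ih =>
    have h1 := (h a (Finset.mem_insert_self _ _)).mul
      (ih fun i hi => h i (Finset.mem_insert_of_mem hi))
    simp only [Finset.prod_insert ha, Finset.sum_insert ha]
    refine h1.congr_deriv ?_
    ring

variable {m : Type*} [Fintype m] [DecidableEq m]

theorem hasDerivAt_entry {M : ℂ → Matrix m m ℂ} {M' : Matrix m m ℂ} {t : ℂ}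
    (hM : HasDerivAt M M' t) (i j : m) : HasDerivAt (fun s => M s i j) (M' i j) t :=
  (LinearMap.toContinuousLinearMap (Matrix.entryLinearMap ℂ ℂ i j)).hasFDerivAt.comp_hasDerivAt t hM

/-- Jacobi's formula: differentiating one column at a time gives the Cramer determinants, and the
adjugate is the determinant times the inverse. -/
theorem hasDerivAt_det {M : ℂ → Matrix m m ℂ} {M' : Matrix m m ℂ} {t : ℂ}
    (hM : HasDerivAt M M' t) (hu : IsUnit (M t).det) :
    HasDerivAt (fun s => (M s).det) ((M t).det * ((M t)⁻¹ * M').trace) t := by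
  have h1 : HasDerivAt (fun s => (M s).det)
      (∑ σ : Equiv.Perm m, (Equiv.Perm.sign σ : ℂ) *
        ∑ i, (∏ j ∈ Finset.univ.erase i, M t (σ j) j) * M' (σ i) i) t := by
    simp only [Matrix.det_apply']
    refine HasDerivAt.fun_sum fun σ _ => HasDerivAt.const_mul _ ?_
    simpa using HasDerivAt.fun_finsetProd (u := Finset.univ) fun i _ => hasDerivAt_entry hM (σ i) i
  refine h1.congr_deriv ?_
  have h2 : ∀ i, ∑ σ : Equiv.Perm m, (Equiv.Perm.sign σ : ℂ) *
      ((∏ j ∈ Finset.univ.erase i, M t (σ j) j) * M' (σ i) i) =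
      ((M t).updateCol i fun k => M' k i).det := by
    intro i
    rw [Matrix.det_apply']
    refine Finset.sum_congr rfl fun σ _ => ?_
    congr 1
    rw [← Finset.mul_prod_erase _ _ (Finset.mem_univ i), Matrix.updateCol_self, mul_comm]
    congr 1
    refine Finset.prod_congr rfl fun j hj => ?_
    rw [Matrix.updateCol_ne (Finset.ne_of_mem_erase hj)]
  simp only [Finset.mul_sum]
  rw [Finset.sum_comm]
  simp only [h2, ← Matrix.cramer_apply, Matrix.cramer_eq_adjugate_mulVec]
  have h3 : (M t).adjugate = (M t).det • (M t)⁻¹ := by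
    rw [Matrix.inv_def, smul_smul, Ring.mul_inverse_cancel _ hu, one_smul]
  rw [h3, Matrix.trace, Finset.mul_sum]
  refine Finset.sum_congr rfl fun i _ => ?_
  simp [Matrix.mulVec, dotProduct, Matrix.mul_apply, Finset.mul_sum, mul_assoc]

theorem hasDerivAt_matrix_inv {M : ℂ → Matrix m m ℂ} {M' : Matrix m m ℂ} {t : ℂ}
    (hM : HasDerivAt M M' t) (hu : IsUnit (M t).det) :
    HasDerivAt (fun s => (M s)⁻¹) (-((M t)⁻¹ * M' * (M t)⁻¹)) t := by
  have hu' : IsUnit (M t) := (Matrix.isUnit_iff_isUnit_det _).2 hu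
  obtain ⟨u, hu2⟩ := hu'
  have h1 := hasFDerivAt_ringInverse (𝕜 := ℂ) u
  rw [hu2] at h1
  have h2 := h1.comp_hasDerivAt t hM
  have h3 : (fun s => (M s)⁻¹) = Ring.inverse ∘ M := by
    funext s
    exact Matrix.nonsing_inv_eq_ringInverse _
  rw [h3]
  refine h2.congr_deriv ?_
  have h4 : (↑u⁻¹ : Matrix m m ℂ) = (M t)⁻¹ := by
    rw [← hu2, Matrix.coe_units_inv]
  simp [h4]

theorem hasDerivAt_exp_mul (X A : Matrix m m ℂ) :
    HasDerivAt (fun t : ℂ => NormedSpace.exp (t • X) * A) (X * A) 0 := by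
  have := (hasDerivAt_exp_smul_const (𝕂 := ℂ) X (0 : ℂ)).mul_const A
  simpa using this

end Flow

/-! ### Euler operators and products of univariate polynomials -/

section Euler

variable {σ : Type*}

/-- The Euler operator `X_l ∂/∂X_l`. -/
def euler (l : σ) : Derivation ℂ (MvPolynomial σ ℂ) (MvPolynomial σ ℂ) :=
  (MvPolynomial.X l : MvPolynomial σ ℂ) • MvPolynomial.pderiv l

theorem euler_apply (l : σ) (p : MvPolynomial σ ℂ) :
    euler l p = MvPolynomial.X l * MvPolynomial.pderiv l p := rfl

theorem euler_monomial (l : σ) (b : σ →₀ ℕ) (c : ℂ) :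
    euler l (MvPolynomial.monomial b c) = (b l : ℂ) • MvPolynomial.monomial b c := by
  classical
  rw [euler_apply, MvPolynomial.pderiv_monomial, MvPolynomial.X, MvPolynomial.monomial_mul,
    MvPolynomial.smul_monomial, one_mul, smul_eq_mul, mul_comm]
  by_cases h : b l = 0
  · simp [h]
  · congr 2
    rw [add_comm]
    exact tsub_add_cancel_of_le (Finsupp.single_le_iff.2 (Nat.one_le_iff_ne_zero.2 h))

theorem coeff_euler (l : σ) (p : MvPolynomial σ ℂ) (b : σ →₀ ℕ) :
    MvPolynomial.coeff b (euler l p) = b l * MvPolynomial.coeff b p := by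
  classical
  induction p using MvPolynomial.induction_on' with
  | monomial a c =>
    rw [euler_monomial, MvPolynomial.coeff_smul, MvPolynomial.coeff_monomial, smul_eq_mul]
    split_ifs with h
    · rw [h]
    · simp
  | add p q hp hq => rw [map_add, MvPolynomial.coeff_add, hp, hq, MvPolynomial.coeff_add, mul_add]

variable [Fintype σ]

theorem prod_aeval_X_eq_sum [DecidableEq σ] {D : ℕ} (p : σ → Polynomial ℂ) (hp : ∀ l, (p l).natDegree ≤ D) :
    ∏ l, Polynomial.aeval (MvPolynomial.X l : MvPolynomial σ ℂ) (p l) =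
      ∑ a ∈ Fintype.piFinset fun _ : σ => Finset.range (D + 1),
        MvPolynomial.monomial (Finsupp.equivFunOnFinite.symm a) (∏ l, (p l).coeff (a l)) := by
  have h : ∀ l, Polynomial.aeval (MvPolynomial.X l : MvPolynomial σ ℂ) (p l) =
      ∑ k ∈ Finset.range (D + 1), MvPolynomial.C ((p l).coeff k) * MvPolynomial.X l ^ k := by
    intro l
    rw [Polynomial.aeval_eq_sum_range' (Nat.lt_succ_of_le (hp l))]
    simp only [MvPolynomial.smul_eq_C_mul]
  simp only [h]
  rw [Finset.prod_univ_sum]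
  refine Finset.sum_congr rfl fun a _ => ?_
  rw [Finset.prod_mul_distrib, MvPolynomial.monomial_eq, map_prod,
    Finsupp.prod_fintype _ _ fun _ => pow_zero _]
  rfl

theorem coeff_prod_aeval_X (p : σ → Polynomial ℂ) (b : σ →₀ ℕ) :
    MvPolynomial.coeff b (∏ l, Polynomial.aeval (MvPolynomial.X l : MvPolynomial σ ℂ) (p l)) =
      ∏ l, (p l).coeff (b l) := by
  classical
  have hle : ∀ l, (p l).natDegree ≤ ∑ l, (p l).natDegree := fun l =>
    Finset.single_le_sum (f := fun l => (p l).natDegree) (fun _ _ => Nat.zero_le _) (Finset.mem_univ l)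
  rw [prod_aeval_X_eq_sum p hle, MvPolynomial.coeff_sum]
  simp only [MvPolynomial.coeff_monomial]
  rw [Finset.sum_eq_single (⇑b)]
  · rw [if_pos]
    exact Finsupp.equivFunOnFinite.symm_apply_apply b
  · intro a _ hab
    rw [if_neg]
    intro h
    exact hab (by rw [← h]; rfl)
  · intro hb
    rw [Fintype.mem_piFinset, not_forall] at hb
    obtain ⟨l, hl⟩ := hb
    rw [Finset.mem_range, not_lt] at hl
    rw [Finset.prod_eq_zero (Finset.mem_univ l), ite_self]
    exact Polynomial.coeff_eq_zero_of_natDegree_lt (lt_of_le_of_lt (hle l) hl)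

/-- The univariate Euler operator. -/
def euler₁ (p : Polynomial ℂ) : Polynomial ℂ := Polynomial.X * Polynomial.derivative p

theorem coeff_euler₁ (p : Polynomial ℂ) (k : ℕ) : (euler₁ p).coeff k = k * p.coeff k := by
  cases k with
  | zero => simp [euler₁]
  | succ k =>
    rw [euler₁, Polynomial.coeff_X_mul, Polynomial.coeff_derivative]
    push_cast; ring

theorem euler_prod_aeval_X [DecidableEq σ] (p : σ → Polynomial ℂ) (l : σ) :
    euler l (∏ i, Polynomial.aeval (MvPolynomial.X i : MvPolynomial σ ℂ) (p i)) =
      ∏ i, Polynomial.aeval (MvPolynomial.X i : MvPolynomial σ ℂ)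
        (Function.update p l (euler₁ (p l)) i) := by
  ext b
  rw [coeff_euler, coeff_prod_aeval_X, coeff_prod_aeval_X,
    ← Finset.mul_prod_erase _ _ (Finset.mem_univ l), ← Finset.mul_prod_erase _ _ (Finset.mem_univ l),
    Function.update_self, coeff_euler₁, mul_assoc]
  congr 2
  refine Finset.prod_congr rfl fun i hi => ?_
  rw [Function.update_of_ne (Finset.ne_of_mem_erase hi)]

theorem eval_prod_aeval_X (p : σ → Polynomial ℂ) (z : σ → ℂ) :
    MvPolynomial.eval z (∏ i, Polynomial.aeval (MvPolynomial.X i : MvPolynomial σ ℂ) (p i)) =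
      ∏ i, (p i).eval (z i) := by
  rw [map_prod]
  refine Finset.prod_congr rfl fun i _ => ?_
  rw [← MvPolynomial.coe_aeval_eq_eval, RingHom.coe_coe, ← Polynomial.aeval_algHom_apply,
    MvPolynomial.aeval_X, Polynomial.coe_aeval_eq_eval]

theorem eval_euler_prod [DecidableEq σ] (p : σ → Polynomial ℂ) (l : σ) {z : σ → ℂ} {c : ℂ}
    (h : (euler₁ (p l)).eval (z l) = (p l).eval (z l) * c) :
    MvPolynomial.eval z
      (euler l (∏ i, Polynomial.aeval (MvPolynomial.X i : MvPolynomial σ ℂ) (p i))) =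
      (∏ i, (p i).eval (z i)) * c := by
  rw [euler_prod_aeval_X, eval_prod_aeval_X, ← Finset.mul_prod_erase _ _ (Finset.mem_univ l),
    ← Finset.mul_prod_erase (s := Finset.univ) (fun i => (p i).eval (z i)) (Finset.mem_univ l),
    Function.update_self, h, mul_right_comm]
  congr 2
  refine Finset.prod_congr rfl fun i hi => ?_
  rw [Function.update_of_ne (Finset.ne_of_mem_erase hi)]

theorem eval_euler_euler_prod [DecidableEq σ] (p : σ → Polynomial ℂ) (l : σ) {z : σ → ℂ} {c : ℂ}
    (h : (euler₁ (euler₁ (p l))).eval (z l) = (p l).eval (z l) * c) :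
    MvPolynomial.eval z
      (euler l (euler l (∏ i, Polynomial.aeval (MvPolynomial.X i : MvPolynomial σ ℂ) (p i)))) =
      (∏ i, (p i).eval (z i)) * c := by
  rw [euler_prod_aeval_X, euler_prod_aeval_X, Function.update_self, Function.update_idem,
    eval_prod_aeval_X, ← Finset.mul_prod_erase _ _ (Finset.mem_univ l),
    ← Finset.mul_prod_erase (s := Finset.univ) (fun i => (p i).eval (z i)) (Finset.mem_univ l),
    Function.update_self, h, mul_right_comm]
  congr 2
  refine Finset.prod_congr rfl fun i hi => ?_
  rw [Function.update_of_ne (Finset.ne_of_mem_erase hi)]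

end Euler

/-! ### Resolvents -/

section Resolvent

variable {m : Type*} [Fintype m] [DecidableEq m]

open scoped Matrix.Norms.L2Operator

/-- The resolvent `(1 - z A)⁻¹`. -/
def resolv (z : ℂ) (A : Matrix m m ℂ) : Matrix m m ℂ := (1 - z • A)⁻¹

/-- `1 - (1 - z A)⁻¹`. -/
def coresolv (z : ℂ) (A : Matrix m m ℂ) : Matrix m m ℂ := 1 - resolv z A

/-- In this form the trace of `coresolv` is visibly the logarithmic derivative of `det (1 - z A)`
under `z d/dz`. Its trace against `X` is the derivative along the flow, so the two kinds of
differentiation can be compared. -/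
theorem coresolv_eq {z : ℂ} {A : Matrix m m ℂ} (h : IsUnit (1 - z • A).det) :
    coresolv z A = -(z • (A * resolv z A)) := by
  have h1 := Matrix.mul_nonsing_inv (1 - z • A) h
  rw [sub_mul, one_mul, Matrix.smul_mul] at h1
  rw [coresolv, resolv]
  nth_rewrite 1 [← h1]
  abel

theorem coresolv_eq' {z : ℂ} {A : Matrix m m ℂ} (h : IsUnit (1 - z • A).det) :
    coresolv z A = -(z • (resolv z A * A)) := by
  have h1 := Matrix.nonsing_inv_mul (1 - z • A) h
  rw [mul_sub, mul_one, Matrix.mul_smul] at h1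
  rw [coresolv, resolv]
  nth_rewrite 1 [← h1]
  abel

theorem resolv_sub_resolv {z w : ℂ} {A : Matrix m m ℂ} (hz : IsUnit (1 - z • A).det)
    (hw : IsUnit (1 - w • A).det) :
    resolv z A - resolv w A = (z - w) • (resolv z A * A * resolv w A) := by
  have h1 : resolv z A * ((1 - w • A) - (1 - z • A)) * resolv w A = resolv z A - resolv w A := by
    rw [mul_sub, sub_mul, resolv, resolv, Matrix.nonsing_inv_mul _ hz, one_mul, mul_assoc,
      Matrix.mul_nonsing_inv _ hw, mul_one]
  rw [← h1]
  have : (1 - w • A) - (1 - z • A) = (z - w) • A := by rw [sub_smul]; abel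
  rw [this, Matrix.mul_smul, Matrix.smul_mul]

/-- The resolvent identity. It makes the loop equations close: the trace of a product at two
distinct points reduces to single traces, that is, to first-order derivatives. -/
theorem coresolv_mul_coresolv {z w : ℂ} {A : Matrix m m ℂ} (hz : IsUnit (1 - z • A).det)
    (hw : IsUnit (1 - w • A).det) (hzw : z ≠ w) :
    coresolv z A * coresolv w A =
      (w - z)⁻¹ • (w • coresolv z A - z • coresolv w A) := by
  have hne : w - z ≠ 0 := sub_ne_zero.2 hzw.symm
  rw [eq_inv_smul_iff₀ hne]
  have h1 := resolv_sub_resolv hz hw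
  have h2 : w • (resolv z A * A * resolv w A) = resolv z A * resolv w A - resolv z A := by
    have := coresolv_eq hw
    rw [coresolv] at this
    rw [mul_assoc, ← Matrix.mul_smul, ← neg_inj, ← Matrix.mul_neg, ← this, mul_sub, mul_one]
    abel
  have h3 : (z - w) • (resolv z A * resolv w A) = z • resolv z A - w • resolv w A := by
    have : resolv z A * resolv w A = w • (resolv z A * A * resolv w A) + resolv z A := by
      rw [h2]; abel
    rw [this, smul_add, smul_comm, ← h1, smul_sub, sub_smul]
    abel
  rw [coresolv, coresolv, sub_mul, mul_sub, mul_sub, one_mul, mul_one, one_mul]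
  have h4 : (w - z) • (resolv z A * resolv w A) = w • resolv w A - z • resolv z A := by
    rw [← neg_sub z w, neg_smul, h3]; abel
  simp only [smul_sub, h4, sub_smul]
  abel

theorem hasDerivAt_one_sub_flow (z : ℂ) (X A : Matrix m m ℂ) :
    HasDerivAt (fun t : ℂ => 1 - z • (NormedSpace.exp (t • X) * A)) (-(z • (X * A))) 0 :=
  ((hasDerivAt_exp_mul X A).const_smul z).const_sub 1

theorem hasDerivAt_det_flow {z : ℂ} (X : Matrix m m ℂ) {A : Matrix m m ℂ}
    (h : IsUnit (1 - z • A).det) :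
    HasDerivAt (fun t : ℂ => (1 - z • (NormedSpace.exp (t • X) * A)).det)
      ((1 - z • A).det * (X * coresolv z A).trace) 0 := by
  have h0 : 1 - z • (NormedSpace.exp ((0 : ℂ) • X) * A) = 1 - z • A := by
    rw [zero_smul, NormedSpace.exp_zero, one_mul]
  have h1 := hasDerivAt_det (hasDerivAt_one_sub_flow z X A) (by rw [h0]; exact h)
  rw [h0] at h1
  refine h1.congr_deriv ?_
  rw [coresolv_eq h, Matrix.mul_neg, Matrix.mul_neg, Matrix.mul_smul, Matrix.mul_smul,
    Matrix.trace_neg, Matrix.trace_neg, Matrix.trace_smul, Matrix.trace_smul,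
    Matrix.trace_mul_comm, mul_assoc]
  rfl

theorem hasDerivAt_coresolv_flow {z : ℂ} (X : Matrix m m ℂ) {A : Matrix m m ℂ}
    (h : IsUnit (1 - z • A).det) (i j : m) :
    HasDerivAt (fun t : ℂ => coresolv z (NormedSpace.exp (t • X) * A) i j)
      ((resolv z A * X * coresolv z A) i j) 0 := by
  have h0 : 1 - z • (NormedSpace.exp ((0 : ℂ) • X) * A) = 1 - z • A := by
    rw [zero_smul, NormedSpace.exp_zero, one_mul]
  have h1 := hasDerivAt_matrix_inv (hasDerivAt_one_sub_flow z X A) (by rw [h0]; exact h)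
  rw [h0] at h1
  have h2 := hasDerivAt_entry (h1.const_sub (1 : Matrix m m ℂ)) i j
  refine h2.congr_deriv ?_
  rw [coresolv_eq h]
  simp only [Matrix.mul_neg, Matrix.neg_mul, Matrix.mul_smul, Matrix.smul_mul, neg_neg, mul_assoc]
  rfl

theorem hasDerivAt_det_inv_flow (r : ℕ) (X : Matrix m m ℂ) {A : Matrix m m ℂ}
    (h : IsUnit A.det) :
    HasDerivAt (fun t : ℂ => ((NormedSpace.exp (t • X) * A).det⁻¹) ^ r)
      ((A.det⁻¹) ^ r * (-(r * X.trace))) 0 := by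
  have h0 : NormedSpace.exp ((0 : ℂ) • X) * A = A := by
    rw [zero_smul, NormedSpace.exp_zero, one_mul]
  have h1 := hasDerivAt_det (hasDerivAt_exp_mul X A) (by rw [h0]; exact h)
  rw [h0] at h1
  have hne := h.ne_zero
  have h2 := (h1.fun_inv (by rw [h0]; exact hne)).fun_pow r
  rw [h0] at h2
  refine h2.congr_deriv ?_
  have h3 : (A⁻¹ * (X * A)).trace = X.trace := by
    rw [Matrix.trace_mul_comm, mul_assoc, Matrix.mul_nonsing_inv _ h, mul_one]
  rw [h3]
  cases r with
  | zero => simp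
  | succ r =>
    rw [Nat.add_sub_cancel, pow_succ]
    have h4 : A.det / A.det ^ 2 = A.det⁻¹ := by field_simp
    linear_combination (-((r + 1 : ℕ) : ℂ) * A.det⁻¹ ^ r * X.trace) * h4

theorem eval_charpolyRev_eq (A : Matrix m m ℂ) (z : ℂ) :
    A.charpolyRev.eval z = (1 - z • A).det := by
  rw [Matrix.charpolyRev, ← Polynomial.coe_evalRingHom, RingHom.map_det]
  congr 1
  ext i j
  rcases eq_or_ne i j with hij | hij <;> simp [hij] <;> ring

theorem hasDerivAt_one_sub_smul (z : ℂ) (A : Matrix m m ℂ) :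
    HasDerivAt (fun t : ℂ => 1 - t • A) (-A) z := by
  simpa using ((hasDerivAt_id z).smul_const A).const_sub 1

theorem eval_euler₁_charpolyRev {z : ℂ} {A : Matrix m m ℂ} (h : IsUnit (1 - z • A).det) :
    (euler₁ A.charpolyRev).eval z = A.charpolyRev.eval z * (coresolv z A).trace := by
  have h1 := hasDerivAt_det (hasDerivAt_one_sub_smul z A) h
  have h2 := A.charpolyRev.hasDerivAt z
  have h3 : (fun x => A.charpolyRev.eval x) = fun t => (1 - t • A).det := by
    funext x; exact eval_charpolyRev_eq A x
  rw [h3] at h2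
  have h4 := h2.unique h1
  rw [euler₁, Polynomial.eval_mul, Polynomial.eval_X, h4, coresolv_eq' h, Matrix.trace_neg,
    Matrix.trace_smul, Matrix.mul_neg, Matrix.trace_neg, eval_charpolyRev_eq, smul_eq_mul, resolv]
  ring

/-- With `R` the coresolvent, `z dR/dz = R (1 - R)`; the rest is the product rule applied to the
first-order formula. -/
theorem eval_euler₁_euler₁_charpolyRev {z : ℂ} {A : Matrix m m ℂ} (h : IsUnit (1 - z • A).det) :
    (euler₁ (euler₁ A.charpolyRev)).eval z = A.charpolyRev.eval z *
      ((coresolv z A).trace ^ 2 + (coresolv z A).trace - (coresolv z A * coresolv z A).trace) := by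
  -- The first-order formula must hold near `z` before it can be differentiated.
  have hopen : ∀ᶠ t in nhds z, IsUnit (1 - t • A).det := by
    have hc : Continuous fun t : ℂ => (1 - t • A).det :=
      (continuous_const.sub (continuous_id.smul continuous_const)).matrix_det
    filter_upwards [hc.continuousAt.eventually_ne h.ne_zero] with t ht
    exact ht.isUnit
  have h1 : HasDerivAt (fun t => coresolv t A)
      (resolv z A * (-A) * resolv z A) z := by
    refine ((hasDerivAt_matrix_inv (hasDerivAt_one_sub_smul z A) h).const_sub 1).congr_deriv ?_
    rw [neg_neg]; rfl
  have h1' : HasDerivAt (fun t => (coresolv t A).trace)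
      (resolv z A * (-A) * resolv z A).trace z :=
    (LinearMap.toContinuousLinearMap (Matrix.traceLinearMap m ℂ ℂ)).hasFDerivAt.comp_hasDerivAt z h1
  have h2 := (A.charpolyRev.hasDerivAt z).fun_mul h1'
  have h3 := ((euler₁ A.charpolyRev).hasDerivAt z).congr_of_eventuallyEq
    (f₁ := fun t => A.charpolyRev.eval t * (coresolv t A).trace)
    (by filter_upwards [hopen] with t ht; exact (eval_euler₁_charpolyRev ht).symm)
  have h4 := h3.unique h2
  have h5 : z * (Polynomial.derivative A.charpolyRev).eval z =
      A.charpolyRev.eval z * (coresolv z A).trace := by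
    rw [← eval_euler₁_charpolyRev h, euler₁, Polynomial.eval_mul, Polynomial.eval_X]
  have h6 : z * (resolv z A * (-A) * resolv z A).trace =
      (coresolv z A).trace - (coresolv z A * coresolv z A).trace := by
    rw [← smul_eq_mul, ← Matrix.trace_smul, ← Matrix.trace_sub]
    congr 1
    have : z • (resolv z A * (-A) * resolv z A) = coresolv z A * resolv z A := by
      rw [coresolv_eq' h, Matrix.mul_neg, Matrix.neg_mul, Matrix.neg_mul, Matrix.smul_mul, smul_neg]
    rw [this]
    have h7 : resolv z A = 1 - coresolv z A := by rw [coresolv]; abel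
    rw [h7, mul_sub, mul_one]
  rw [euler₁, Polynomial.eval_mul, Polynomial.eval_X, h4]
  linear_combination (coresolv z A).trace * h5 + A.charpolyRev.eval z * h6

theorem isUnit_det_one_sub_smul {N : ℕ} {z : ℂ} (hz : ‖z‖ < 1) (A : U N) :
    IsUnit (1 - z • (A : Matrix (Fin N) (Fin N) ℂ)).det := by
  rw [← Matrix.isUnit_iff_isUnit_det]
  -- For `N = 0` the matrix ring is trivial and unitaries do not have norm one.
  rcases N.eq_zero_or_pos with rfl | hN
  · exact isUnit_of_subsingleton _
  · have : Nonempty (Fin N) := ⟨⟨0, hN⟩⟩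
    refine isUnit_one_sub_of_norm_lt_one ?_
    rw [norm_smul, CStarRing.norm_of_mem_unitary A.2, mul_one]
    exact hz

theorem continuous_resolv {N : ℕ} {z : ℂ} (hz : ‖z‖ < 1) :
    Continuous fun A : U N => resolv z (A : Matrix (Fin N) (Fin N) ℂ) := by
  have hc : Continuous fun A : U N => 1 - z • (A : Matrix (Fin N) (Fin N) ℂ) :=
    continuous_const.sub (continuous_subtype_val.const_smul z)
  simp only [resolv, Matrix.inv_def, Ring.inverse_eq_inv']
  exact (hc.matrix_det.inv₀ fun A => (isUnit_det_one_sub_smul hz A).ne_zero).smul hc.matrix_adjugate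

theorem continuous_coresolv {N : ℕ} {z : ℂ} (hz : ‖z‖ < 1) :
    Continuous fun A : U N => coresolv z (A : Matrix (Fin N) (Fin N) ℂ) :=
  continuous_const.sub (continuous_resolv hz)

end Resolvent

/-! ### The averaged polynomial -/

theorem natDegree_charpolyRev_le {N : ℕ} (A : Matrix (Fin N) (Fin N) ℂ) :
    A.charpolyRev.natDegree ≤ N := by
  rw [← Matrix.reverse_charpoly]
  refine (Polynomial.reverse_natDegree_le _).trans ?_
  rw [Matrix.charpoly_natDegree_eq_dim, Fintype.card_fin]

theorem continuous_coeff_charpolyRev (N k : ℕ) :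
    Continuous fun A : U N => (A : Matrix (Fin N) (Fin N) ℂ).charpolyRev.coeff k := by
  have h : ∀ A : U N, (A : Matrix (Fin N) (Fin N) ℂ).charpolyRev.coeff k =
      MvPolynomial.eval (fun ij : Fin N × Fin N => (A : Matrix (Fin N) (Fin N) ℂ) ij.1 ij.2)
        ((Matrix.charpoly.univ ℂ (Fin N)).coeff (Polynomial.revAt N k)) := by
    intro A
    rw [← Matrix.reverse_charpoly, Polynomial.coeff_reverse, Matrix.charpoly_natDegree_eq_dim,
      Fintype.card_fin]
    have := Matrix.charpoly.univ_coeff_eval₂Hom (R := ℂ) (n := Fin N) (RingHom.id ℂ)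
      (fun ij : Fin N × Fin N => (A : Matrix (Fin N) (Fin N) ℂ) ij.1 ij.2) (Polynomial.revAt N k)
    exact this.symm
  simp only [h]
  refine (MvPolynomial.continuous_eval _).comp ?_
  exact continuous_pi fun ij => (continuous_subtype_val.matrix_elem ij.1 ij.2)

/-- The polynomial `det(A)^{-r} ∏_l det(1 - X_l A)`. -/
def charProd (r n : ℕ) {N : ℕ} (A : U N) : MvPolynomial (Fin n) ℂ :=
  MvPolynomial.C (star (A : Matrix (Fin N) (Fin N) ℂ).det ^ r) *
    ∏ l, Polynomial.aeval (MvPolynomial.X l : MvPolynomial (Fin n) ℂ)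
      (A : Matrix (Fin N) (Fin N) ℂ).charpolyRev

theorem coeff_charProd (r n : ℕ) {N : ℕ} (A : U N) (b : Fin n →₀ ℕ) :
    MvPolynomial.coeff b (charProd r n A) = star (A : Matrix (Fin N) (Fin N) ℂ).det ^ r *
      ∏ l, (A : Matrix (Fin N) (Fin N) ℂ).charpolyRev.coeff (b l) := by
  rw [charProd, MvPolynomial.coeff_C_mul, coeff_prod_aeval_X]

theorem charProd_eq_sum (r n : ℕ) {N : ℕ} (A : U N) :
    charProd r n A = ∑ a ∈ Fintype.piFinset fun _ : Fin n => Finset.range (N + 1),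
      MvPolynomial.coeff (Finsupp.equivFunOnFinite.symm a) (charProd r n A) •
        MvPolynomial.monomial (Finsupp.equivFunOnFinite.symm a) 1 := by
  simp only [coeff_charProd]
  rw [charProd, prod_aeval_X_eq_sum _ fun _ => natDegree_charpolyRev_le _, Finset.mul_sum]
  refine Finset.sum_congr rfl fun a _ => ?_
  rw [MvPolynomial.C_mul_monomial, MvPolynomial.smul_monomial, smul_eq_mul, mul_one]
  rfl

theorem continuous_coeff_charProd (r n N : ℕ) (b : Fin n →₀ ℕ) :
    Continuous fun A : U N => MvPolynomial.coeff b (charProd r n A) := by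
  simp only [coeff_charProd]
  refine Continuous.mul ((Continuous.star ?_).pow r)
    (continuous_finsetProd _ fun l _ => continuous_coeff_charpolyRev N _)
  exact continuous_subtype_val.matrix_det

/-- The Haar average of `charProd`. -/
def avgCharProd (r n N : ℕ) : MvPolynomial (Fin n) ℂ :=
  ∑ a ∈ Fintype.piFinset fun _ : Fin n => Finset.range (N + 1),
    (∫ A : U N, MvPolynomial.coeff (Finsupp.equivFunOnFinite.symm a) (charProd r n A) ∂(haarU N)) •
      MvPolynomial.monomial (Finsupp.equivFunOnFinite.symm a) 1

/-- All `charProd r n A` lie in one finite-dimensional space of polynomials, so linear functionals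
commute with the average. Evaluation, coefficients and the differential operators are all used in
this way. -/
theorem map_avgCharProd (r n N : ℕ) (L : MvPolynomial (Fin n) ℂ →ₗ[ℂ] ℂ) :
    L (avgCharProd r n N) = ∫ A : U N, L (charProd r n A) ∂(haarU N) := by
  have h : ∀ A : U N, L (charProd r n A) =
      ∑ a ∈ Fintype.piFinset fun _ : Fin n => Finset.range (N + 1),
      MvPolynomial.coeff (Finsupp.equivFunOnFinite.symm a) (charProd r n A) *
        L (MvPolynomial.monomial (Finsupp.equivFunOnFinite.symm a) 1) := by
    intro A
    conv_lhs => rw [charProd_eq_sum]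
    simp only [map_sum, map_smul, smul_eq_mul]
  simp only [h]
  rw [integral_finsetSum _ fun a _ =>
    (integrable_haarU (continuous_coeff_charProd r n N _)).mul_const _]
  simp only [avgCharProd, map_sum, map_smul, smul_eq_mul, integral_mul_const]

/-- The inverse is holomorphic in the entries, unlike the conjugate, and so can be differentiated
along the flow in complex time. -/
theorem star_det_eq_inv {N : ℕ} (A : U N) :
    star (A : Matrix (Fin N) (Fin N) ℂ).det = (A : Matrix (Fin N) (Fin N) ℂ).det⁻¹ := by
  have h := (Matrix.det_of_mem_unitary A.2)
  rw [eq_comm]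
  exact inv_eq_of_mul_eq_one_left (Unitary.star_mul_self_of_mem h)

theorem isUnit_det {N : ℕ} (A : U N) : IsUnit (A : Matrix (Fin N) (Fin N) ℂ).det :=
  Matrix.UnitaryGroup.det_isUnit A

theorem eval_charProd (r n : ℕ) {N : ℕ} (A : U N) (z : Fin n → ℂ) :
    MvPolynomial.eval z (charProd r n A) = ((A : Matrix (Fin N) (Fin N) ℂ).det⁻¹) ^ r *
      ∏ l, (1 - z l • (A : Matrix (Fin N) (Fin N) ℂ)).det := by
  rw [charProd, map_mul, MvPolynomial.eval_C, star_det_eq_inv, eval_prod_aeval_X]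
  simp only [eval_charpolyRev_eq]

theorem eval_euler_charProd (r : ℕ) {n N : ℕ} (A : U N) {z : Fin n → ℂ} (l : Fin n)
    (hz : ‖z l‖ < 1) :
    MvPolynomial.eval z (euler l (charProd r n A)) = MvPolynomial.eval z (charProd r n A) *
      (coresolv (z l) (A : Matrix (Fin N) (Fin N) ℂ)).trace := by
  rw [charProd, ← MvPolynomial.smul_eq_C_mul, Derivation.map_smul, MvPolynomial.smul_eval,
    eval_euler_prod (fun _ => A.1.charpolyRev) l (eval_euler₁_charpolyRev (isUnit_det_one_sub_smul hz A)),
    MvPolynomial.smul_eval, eval_prod_aeval_X, mul_assoc]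

theorem eval_euler_euler_charProd (r : ℕ) {n N : ℕ} (A : U N) {z : Fin n → ℂ} (l : Fin n)
    (hz : ‖z l‖ < 1) :
    MvPolynomial.eval z (euler l (euler l (charProd r n A))) =
      MvPolynomial.eval z (charProd r n A) *
      ((coresolv (z l) (A : Matrix (Fin N) (Fin N) ℂ)).trace ^ 2 +
        (coresolv (z l) (A : Matrix (Fin N) (Fin N) ℂ)).trace -
        (coresolv (z l) (A : Matrix (Fin N) (Fin N) ℂ) * coresolv (z l) A).trace) := by
  rw [charProd, ← MvPolynomial.smul_eq_C_mul, Derivation.map_smul, Derivation.map_smul, MvPolynomial.smul_eval,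
    eval_euler_euler_prod (fun _ => A.1.charpolyRev) l (eval_euler₁_euler₁_charpolyRev (isUnit_det_one_sub_smul hz A)),
    MvPolynomial.smul_eval, eval_prod_aeval_X, mul_assoc]

/-! ### First and second order loop equations -/

section Loop

open scoped Matrix.Norms.L2Operator

variable {N n : ℕ} (r : ℕ) (z : Fin n → ℂ)

/-- `det(A)^{-r} ∏_l det(1 - z_l A)` as a function of the matrix `A`. -/
def charFun (A : Matrix (Fin N) (Fin N) ℂ) : ℂ :=
  (A.det⁻¹) ^ r * ∏ l, (1 - z l • A).det

/-- The logarithmic gradient of `charFun`. -/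
def logGrad (A : Matrix (Fin N) (Fin N) ℂ) : Matrix (Fin N) (Fin N) ℂ :=
  ∑ l, coresolv (z l) A - (r : ℂ) • 1

theorem continuous_charFun : Continuous fun A : U N => charFun r z (A : Matrix (Fin N) (Fin N) ℂ) := by
  unfold charFun
  refine Continuous.mul (Continuous.pow (Continuous.inv₀ ?_ fun A => (isUnit_det A).ne_zero) r)
    (continuous_finsetProd _ fun l _ => Continuous.matrix_det ?_)
  · exact continuous_subtype_val.matrix_det
  · exact continuous_const.sub (continuous_subtype_val.const_smul (z l))

variable {z}

theorem continuous_logGrad (hz : ∀ l, ‖z l‖ < 1) :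
    Continuous fun A : U N => logGrad r z (A : Matrix (Fin N) (Fin N) ℂ) :=
  (continuous_finsetSum _ fun l _ => continuous_coresolv (hz l)).sub continuous_const

theorem hasDerivAt_charFun (hz : ∀ l, ‖z l‖ < 1) (A : U N) (X : Matrix (Fin N) (Fin N) ℂ) :
    HasDerivAt (fun t : ℂ => charFun r z (NormedSpace.exp (t • X) * (A : Matrix (Fin N) (Fin N) ℂ)))
      (charFun r z (A : Matrix (Fin N) (Fin N) ℂ) * (X * logGrad r z A).trace) 0 := by
  have h0 : NormedSpace.exp ((0 : ℂ) • X) * (A : Matrix (Fin N) (Fin N) ℂ) = A := by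
    rw [zero_smul, NormedSpace.exp_zero, one_mul]
  have h1 := hasDerivAt_prod_log Finset.univ (t := 0)
    (u := fun l t => (1 - z l • (NormedSpace.exp (t • X) * (A : Matrix (Fin N) (Fin N) ℂ))).det)
    (c := fun l => (X * coresolv (z l) (A : Matrix (Fin N) (Fin N) ℂ)).trace)
    (fun l _ => by
      simp only [h0]
      exact hasDerivAt_det_flow X (isUnit_det_one_sub_smul (hz l) A))
  have h2 := (hasDerivAt_det_inv_flow r X (isUnit_det A)).fun_mul h1
  simp only [h0] at h2
  refine h2.congr_deriv ?_
  rw [charFun, logGrad, Matrix.mul_sub, Matrix.trace_sub, Matrix.mul_sum, Matrix.trace_sum,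
    Matrix.mul_smul, mul_one, Matrix.trace_smul, smul_eq_mul]
  ring

/-- The invariance in the direction `X = 1`, which is the source of homogeneity. -/
theorem integral_charFun_trace_logGrad (hz : ∀ l, ‖z l‖ < 1) :
    ∫ A : U N, charFun r z (A : Matrix (Fin N) (Fin N) ℂ) *
      (logGrad r z (A : Matrix (Fin N) (Fin N) ℂ)).trace ∂(haarU N) = 0 := by
  have h := integral_deriv_eq_zero (N := N) (f := charFun r z)
    (fun A => charFun r z (A : Matrix (Fin N) (Fin N) ℂ) • (Matrix.traceLinearMap (Fin N) ℂ ℂ ∘ₗ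
      LinearMap.mulRight ℂ (logGrad r z (A : Matrix (Fin N) (Fin N) ℂ))))
    (continuous_charFun r z) (fun X => (continuous_charFun r z).mul
      (continuous_const.mul (continuous_logGrad r hz)).matrix_trace)
    (fun A X => hasDerivAt_charFun r hz A X) 1
  simpa using h

/-- The Casimir operator of `gl_N`: differentiate `charFun * logGrad i j` in the direction of the
matrix unit `E_ij` and sum. The factor `charFun` contributes `L_ji L_ij`, with `L` the logarithmic
gradient; the factor `L_ij` contributes `resolv_ii * coresolv_jj`. -/
theorem integral_casimir (hz : ∀ l, ‖z l‖ < 1) :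
    ∫ A : U N, charFun r z (A : Matrix (Fin N) (Fin N) ℂ) *
      ((logGrad r z (A : Matrix (Fin N) (Fin N) ℂ) * logGrad r z A).trace +
        ∑ l, (resolv (z l) (A : Matrix (Fin N) (Fin N) ℂ)).trace *
          (coresolv (z l) (A : Matrix (Fin N) (Fin N) ℂ)).trace) ∂(haarU N) = 0 := by
  let G : Fin N → Fin N → U N → Matrix (Fin N) (Fin N) ℂ →ₗ[ℂ] ℂ := fun i j A =>
    { toFun := fun X => charFun r z (A : Matrix (Fin N) (Fin N) ℂ) *
        ((X * logGrad r z A).trace * logGrad r z (A : Matrix (Fin N) (Fin N) ℂ) i j +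
          ∑ l, (resolv (z l) (A : Matrix (Fin N) (Fin N) ℂ) * X * coresolv (z l) A.1) i j)
      map_add' := fun X Y => by
        simp only [Matrix.add_mul, Matrix.mul_add, Matrix.trace_add, Matrix.add_apply,
          Finset.sum_add_distrib]
        ring
      map_smul' := fun c X => by
        simp only [Matrix.smul_mul, Matrix.mul_smul, Matrix.trace_smul, Matrix.smul_apply,
          smul_eq_mul, ← Finset.mul_sum, RingHom.id_apply]
        ring }
  have hGc : ∀ i j X, Continuous fun A => G i j A X := by
    intro i j X
    have hT := continuous_logGrad (N := N) r hz
    refine (continuous_charFun r z).mul (((continuous_const.mul hT).matrix_trace.mul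
      (hT.matrix_elem i j)).add (continuous_finsetSum _ fun l _ => ?_))
    exact (((continuous_resolv (hz l)).mul continuous_const).mul
      (continuous_coresolv (hz l))).matrix_elem i j
  have hG : ∀ i j X, ∫ A, G i j A X ∂(haarU N) = 0 := by
    intro i j X
    refine integral_deriv_eq_zero (N := N)
      (f := fun A => charFun r z A * logGrad r z A i j) (G i j)
      ((continuous_charFun r z).mul ((continuous_logGrad r hz).matrix_elem i j)) (hGc i j) ?_ X
    intro A X
    have h0 : NormedSpace.exp ((0 : ℂ) • X) * (A : Matrix (Fin N) (Fin N) ℂ) = A := by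
      rw [zero_smul, NormedSpace.exp_zero, one_mul]
    have h1 : HasDerivAt (fun t : ℂ => logGrad r z
        (NormedSpace.exp (t • X) * (A : Matrix (Fin N) (Fin N) ℂ)) i j)
        (∑ l, (resolv (z l) (A : Matrix (Fin N) (Fin N) ℂ) * X * coresolv (z l) A.1) i j) 0 := by
      simp only [logGrad, Matrix.sub_apply, Matrix.sum_apply]
      exact (HasDerivAt.fun_sum fun l _ =>
        hasDerivAt_coresolv_flow X (isUnit_det_one_sub_smul (hz l) A) i j).sub_const _
    refine ((hasDerivAt_charFun r hz A X).fun_mul h1).congr_deriv ?_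
    simp only [h0, G, LinearMap.coe_mk, AddHom.coe_mk]
    ring
  have hsum : ∀ A : U N, charFun r z (A : Matrix (Fin N) (Fin N) ℂ) *
      ((logGrad r z (A : Matrix (Fin N) (Fin N) ℂ) * logGrad r z A).trace +
        ∑ l, (resolv (z l) (A : Matrix (Fin N) (Fin N) ℂ)).trace *
          (coresolv (z l) (A : Matrix (Fin N) (Fin N) ℂ)).trace) =
      ∑ i, ∑ j, G i j A (Matrix.single i j 1) := by
    intro A
    simp only [G, LinearMap.coe_mk, AddHom.coe_mk, ← Finset.mul_sum, Finset.sum_add_distrib]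
    congr 2
    · simp only [Matrix.trace_single_mul, one_mul, smul_eq_mul]
      rw [Finset.sum_comm]
      simp only [Matrix.trace, Matrix.diag_apply, Matrix.mul_apply]
    · have h1 : ∀ (P Q : Matrix (Fin N) (Fin N) ℂ) (i j : Fin N),
          (P * (Matrix.single i j 1 : Matrix (Fin N) (Fin N) ℂ) * Q) i j = P i i * Q j j := by
        intro P Q i j
        rw [mul_assoc, Matrix.mul_apply, Finset.sum_eq_single i]
        · rw [Matrix.single_mul_apply_same, one_mul]
        · intro k _ hk
          rw [Matrix.single_mul_apply_of_ne _ _ _ _ _ hk, mul_zero]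
        · intro h
          exact absurd (Finset.mem_univ i) h
      simp only [h1]
      have h2 : ∀ i : Fin N, ∑ j : Fin N, ∑ l, resolv (z l) (A : Matrix (Fin N) (Fin N) ℂ) i i * coresolv (z l) A.1 j j =
          ∑ l, resolv (z l) (A : Matrix (Fin N) (Fin N) ℂ) i i * (coresolv (z l) A.1).trace := by
        intro i
        rw [Finset.sum_comm]
        simp only [← Finset.mul_sum, Matrix.trace, Matrix.diag_apply]
      simp only [h2]
      rw [Finset.sum_comm]
      simp only [← Finset.sum_mul, Matrix.trace, Matrix.diag_apply]
  simp only [hsum]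
  rw [integral_finsetSum _ fun i _ => integrable_finsetSum _ fun j _ => integrable_haarU (hGc i j _)]
  refine Finset.sum_eq_zero fun i _ => ?_
  rw [integral_finsetSum _ fun j _ => integrable_haarU (hGc i j _)]
  exact Finset.sum_eq_zero fun j _ => hG i j _

end Loop

/-! ### The differential equation of the averaged polynomial -/

section PDE

variable {N n : ℕ} (r : ℕ) {z : Fin n → ℂ}

theorem sum_sum_eq_diag_add {f : Fin n → Fin n → ℂ} (hf : ∀ i j, f i j = f j i) :
    ∑ i, ∑ j, f i j = ∑ i, f i i + 2 * ∑ i, ∑ j ∈ Finset.Ioi i, f i j := by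
  have h1 := Finset.sum_sum_Ioi_add_eq_sum_sum_off_diag f
  have h2 : ∑ i, ∑ j ∈ Finset.Ioi i, (f j i + f i j) = 2 * ∑ i, ∑ j ∈ Finset.Ioi i, f i j := by
    simp only [Finset.mul_sum]
    refine Finset.sum_congr rfl fun i _ => Finset.sum_congr rfl fun j _ => ?_
    rw [hf j i]; ring
  rw [← h2, h1, ← Finset.sum_add_distrib]
  refine Finset.sum_congr rfl fun i _ => ?_
  rw [Fintype.sum_eq_add_sum_compl i]
  congr 1
  exact Finset.sum_congr rfl fun j _ => hf i j

theorem sum_sum_Ioi_add_eq (a : Fin n → ℂ) :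
    ∑ i, ∑ j ∈ Finset.Ioi i, (a i + a j) = ((n : ℂ) - 1) * ∑ i, a i := by
  have h1 := Finset.sum_sum_Ioi_add_eq_sum_sum_off_diag fun _ i : Fin n => a i
  rw [h1, Finset.mul_sum]
  refine Finset.sum_congr rfl fun i _ => ?_
  rw [Finset.sum_const, Finset.card_compl, Finset.card_singleton, Fintype.card_fin, nsmul_eq_mul]
  have : 1 ≤ n := Nat.succ_le_of_lt (Fin.pos i)
  push_cast [this]
  ring

theorem charFun_eq_eval (A : U N) :
    charFun r z (A : Matrix (Fin N) (Fin N) ℂ) = MvPolynomial.eval z (charProd r n A) :=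
  (eval_charProd r n A z).symm

/-- The traces `tr R_l²` and `(tr R_l)²` combine exactly into the second Euler derivatives, and the
mixed traces `tr (R_i R_j)` reduce to first derivatives. The points must be distinct for the latter.
-/
theorem casimir_eq (hz : ∀ l, ‖z l‖ < 1) (hinj : Function.Injective z) (A : U N) :
    charFun r z (A : Matrix (Fin N) (Fin N) ℂ) *
      ((logGrad r z (A : Matrix (Fin N) (Fin N) ℂ) * logGrad r z A).trace +
        ∑ l, (resolv (z l) (A : Matrix (Fin N) (Fin N) ℂ)).trace *
          (coresolv (z l) (A : Matrix (Fin N) (Fin N) ℂ)).trace) =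
      -∑ l, MvPolynomial.eval z (euler l (euler l (charProd r n A))) +
      (1 + N - 2 * r) * ∑ l, MvPolynomial.eval z (euler l (charProd r n A)) +
      r ^ 2 * N * MvPolynomial.eval z (charProd r n A) +
      2 * ∑ i, ∑ j ∈ Finset.Ioi i, (z j - z i)⁻¹ *
        (z j * MvPolynomial.eval z (euler i (charProd r n A)) -
          z i * MvPolynomial.eval z (euler j (charProd r n A))) := by
  have hu : ∀ l, IsUnit (1 - z l • (A : Matrix (Fin N) (Fin N) ℂ)).det :=
    fun l => isUnit_det_one_sub_smul (hz l) A
  simp only [eval_euler_euler_charProd r A _ (hz _), eval_euler_charProd r A _ (hz _),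
    charFun_eq_eval]
  set φ := MvPolynomial.eval z (charProd r n A)
  set R : Fin n → Matrix (Fin N) (Fin N) ℂ := fun l => coresolv (z l) A.1 with hR
  have hS : ∀ l, (resolv (z l) A.1).trace = N - (R l).trace := by
    intro l
    have : resolv (z l) A.1 = 1 - R l := by rw [hR]; simp [coresolv]
    rw [this, Matrix.trace_sub, Matrix.trace_one, Fintype.card_fin]
  have hT : (logGrad r z A.1 * logGrad r z A.1).trace =
      ∑ i, (R i * R i).trace + 2 * ∑ i, ∑ j ∈ Finset.Ioi i, (R i * R j).trace -
        2 * r * ∑ l, (R l).trace + r ^ 2 * N := by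
    rw [← sum_sum_eq_diag_add (f := fun i j => (R i * R j).trace)
      fun i j => Matrix.trace_mul_comm _ _]
    have : logGrad r z A.1 = ∑ l, R l - (r : ℂ) • 1 := rfl
    rw [this]
    simp only [Matrix.sub_mul, Matrix.mul_sub, Matrix.smul_mul, Matrix.mul_smul, one_mul, mul_one,
      Matrix.trace_sub, Matrix.trace_smul, Matrix.sum_mul, Matrix.mul_sum, Matrix.trace_sum,
      Matrix.trace_one, Fintype.card_fin, smul_eq_mul, Finset.sum_sub_distrib, ← Finset.mul_sum]
    rw [Finset.sum_comm (f := fun i j => (R j * R i).trace)]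
    ring
  have hcross : ∀ i : Fin n, ∀ j ∈ Finset.Ioi i, (R i * R j).trace =
      (z j - z i)⁻¹ * (z j * (R i).trace - z i * (R j).trace) := by
    intro i j hij
    have hne : z i ≠ z j := fun h => (Finset.mem_Ioi.1 hij).ne (hinj h)
    rw [hR]
    simp only
    rw [coresolv_mul_coresolv (hu i) (hu j) hne, Matrix.trace_smul, Matrix.trace_sub,
      Matrix.trace_smul, Matrix.trace_smul]
    rfl
  have hcross2 : ∑ i, ∑ j ∈ Finset.Ioi i, (z j - z i)⁻¹ *
      (z j * (φ * (R i).trace) - z i * (φ * (R j).trace)) =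
      φ * ∑ i, ∑ j ∈ Finset.Ioi i, (R i * R j).trace := by
    simp only [Finset.mul_sum]
    refine Finset.sum_congr rfl fun i _ => Finset.sum_congr rfl fun j hj => ?_
    rw [hcross i j hj]; ring
  have hRl : ∀ l, coresolv (z l) A.1 = R l := fun _ => rfl
  rw [hT]
  simp only [hRl, hS, ← Finset.mul_sum]
  rw [hcross2]
  simp only [Finset.sum_sub_distrib, Finset.sum_add_distrib, sub_mul, ← Finset.mul_sum, pow_two]
  ring

theorem eval_pde_avgCharProd (hz : ∀ l, ‖z l‖ < 1) (hinj : Function.Injective z) :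
    -∑ l, MvPolynomial.eval z (euler l (euler l (avgCharProd r n N))) +
      (1 + N - 2 * r) * ∑ l, MvPolynomial.eval z (euler l (avgCharProd r n N)) +
      r ^ 2 * N * MvPolynomial.eval z (avgCharProd r n N) +
      2 * ∑ i, ∑ j ∈ Finset.Ioi i, (z j - z i)⁻¹ *
        (z j * MvPolynomial.eval z (euler i (avgCharProd r n N)) -
          z i * MvPolynomial.eval z (euler j (avgCharProd r n N))) = 0 := by
  let ev : MvPolynomial (Fin n) ℂ →ₗ[ℂ] ℂ := (MvPolynomial.aeval z).toLinearMap
  let θ : Fin n → MvPolynomial (Fin n) ℂ →ₗ[ℂ] MvPolynomial (Fin n) ℂ := fun l => (euler l).toLinearMap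
  let L : MvPolynomial (Fin n) ℂ →ₗ[ℂ] ℂ := -∑ l, ev ∘ₗ θ l ∘ₗ θ l +
    (1 + N - 2 * r : ℂ) • ∑ l, ev ∘ₗ θ l + (r ^ 2 * N : ℂ) • ev +
    (2 : ℂ) • ∑ i, ∑ j ∈ Finset.Ioi i, (z j - z i)⁻¹ • (z j • ev ∘ₗ θ i - z i • ev ∘ₗ θ j)
  have hL : ∀ p, L p = -∑ l, MvPolynomial.eval z (euler l (euler l p)) +
      (1 + N - 2 * r) * ∑ l, MvPolynomial.eval z (euler l p) +
      r ^ 2 * N * MvPolynomial.eval z p +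
      2 * ∑ i, ∑ j ∈ Finset.Ioi i, (z j - z i)⁻¹ *
        (z j * MvPolynomial.eval z (euler i p) - z i * MvPolynomial.eval z (euler j p)) := by
    intro p
    simp only [L, LinearMap.add_apply, LinearMap.neg_apply, LinearMap.smul_apply,
      LinearMap.sum_apply, LinearMap.sub_apply, LinearMap.comp_apply, smul_eq_mul]
    rfl
  rw [← hL, map_avgCharProd, ← integral_casimir (N := N) r hz]
  refine integral_congr_ae (Filter.Eventually.of_forall fun A => ?_)
  simp only
  rw [hL, casimir_eq r hz hinj]

theorem infinite_ball : (Metric.ball (0 : ℂ) 1).Infinite :=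
  infinite_of_mem_nhds 0 (Metric.ball_mem_nhds 0 one_pos)

theorem eq_of_eval_ball {p q : MvPolynomial (Fin n) ℂ}
    (h : ∀ z : Fin n → ℂ, (∀ l, ‖z l‖ < 1) → MvPolynomial.eval z p = MvPolynomial.eval z q) :
    p = q := by
  refine MvPolynomial.funext_set (fun _ => Metric.ball (0 : ℂ) 1) (fun _ => infinite_ball) ?_
  intro z hz
  refine h z fun l => ?_
  have := hz l (Set.mem_univ l)
  rwa [mem_ball_zero_iff] at this

theorem sum_euler_avgCharProd (r n N : ℕ) :
    ∑ l, euler l (avgCharProd r n N) = (r * N : ℂ) • avgCharProd r n N := by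
  refine eq_of_eval_ball fun z hz => ?_
  rw [← sub_eq_zero, map_sum, MvPolynomial.smul_eval]
  let ev : MvPolynomial (Fin n) ℂ →ₗ[ℂ] ℂ := (MvPolynomial.aeval z).toLinearMap
  let L : MvPolynomial (Fin n) ℂ →ₗ[ℂ] ℂ := ∑ l, ev ∘ₗ (euler l).toLinearMap - (r * N : ℂ) • ev
  have hL : ∀ p, L p = ∑ l, MvPolynomial.eval z (euler l p) - r * N * MvPolynomial.eval z p := by
    intro p
    simp only [L, LinearMap.smul_apply, LinearMap.sum_apply, LinearMap.sub_apply,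
      LinearMap.comp_apply, smul_eq_mul]
    rfl
  rw [← hL, map_avgCharProd, ← integral_charFun_trace_logGrad (N := N) r hz]
  refine integral_congr_ae (Filter.Eventually.of_forall fun A => ?_)
  simp only
  rw [hL]
  simp only [eval_euler_charProd r A _ (hz _), charFun_eq_eval, logGrad, Matrix.trace_sub,
    Matrix.trace_sum, Matrix.trace_smul, Matrix.trace_one, Fintype.card_fin, smul_eq_mul,
    ← Finset.mul_sum]
  ring

/-! ### Multiplication by the Vandermonde determinant -/

/-- The Vandermonde polynomial `∏_{i<j} (X_j - X_i)`. -/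
def vand (n : ℕ) : MvPolynomial (Fin n) ℂ :=
  (Matrix.vandermonde fun i : Fin n => (MvPolynomial.X i : MvPolynomial (Fin n) ℂ)).det

theorem vand_ne_zero (n : ℕ) : vand n ≠ 0 :=
  Matrix.det_vandermonde_ne_zero_iff.2 (MvPolynomial.X_injective)

theorem prod_X_pow_perm (e : Fin n → ℕ) (σ : Equiv.Perm (Fin n)) :
    ∏ i, (MvPolynomial.X (σ i) : MvPolynomial (Fin n) ℂ) ^ e i =
      MvPolynomial.monomial ((Finsupp.equivFunOnFinite.symm e).mapDomain σ) 1 := by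
  rw [← MvPolynomial.rename_monomial, MvPolynomial.monomial_eq,
    Finsupp.prod_fintype _ _ fun _ => pow_zero _]
  simp

theorem det_X_pow (e : Fin n → ℕ) :
    (Matrix.of fun i j : Fin n => (MvPolynomial.X i : MvPolynomial (Fin n) ℂ) ^ e j).det =
      ∑ σ : Equiv.Perm (Fin n), (Equiv.Perm.sign σ : ℂ) •
        MvPolynomial.monomial ((Finsupp.equivFunOnFinite.symm e).mapDomain σ) 1 := by
  rw [Matrix.det_apply']
  refine Finset.sum_congr rfl fun σ _ => ?_
  simp only [Matrix.of_apply]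
  rw [prod_X_pow_perm, MvPolynomial.smul_eq_C_mul]
  simp

theorem mapDomain_perm_apply (b : Fin n →₀ ℕ) (σ : Equiv.Perm (Fin n)) (i : Fin n) :
    b.mapDomain σ i = b (σ.symm i) := by
  rw [Finsupp.mapDomain_equiv_apply]

/-- The exponents in every monomial of the Vandermonde polynomial are a permutation of `0, …, n-1`.
-/
theorem sum_euler_euler_vand :
    ∑ l, euler l (euler l (vand n)) = (∑ j : Fin n, ((j : ℕ) : ℂ) ^ 2) • vand n := by
  have h : vand n = ∑ σ : Equiv.Perm (Fin n), (Equiv.Perm.sign σ : ℂ) •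
      MvPolynomial.monomial
        ((Finsupp.equivFunOnFinite.symm fun j : Fin n => (j : ℕ)).mapDomain σ) 1 := by
    rw [← det_X_pow]; rfl
  ext b
  rw [MvPolynomial.coeff_sum, MvPolynomial.coeff_smul]
  simp only [coeff_euler, ← mul_assoc]
  rw [← Finset.sum_mul, h, MvPolynomial.coeff_sum, smul_eq_mul, Finset.mul_sum, Finset.mul_sum]
  refine Finset.sum_congr rfl fun σ _ => ?_
  rw [MvPolynomial.coeff_smul, MvPolynomial.coeff_monomial]
  split_ifs with hb
  · congr 1
    rw [← hb]
    simp only [mapDomain_perm_apply, ← pow_two]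
    exact Equiv.sum_comp σ.symm (fun j : Fin n => ((j : ℕ) : ℂ) ^ 2)
  · simp

theorem eval_derivation_prod (d : Derivation ℂ (MvPolynomial (Fin n) ℂ) (MvPolynomial (Fin n) ℂ))
    {ι : Type*} (s : Finset ι) (f : ι → MvPolynomial (Fin n) ℂ)
    (hf : ∀ i ∈ s, MvPolynomial.eval z (f i) ≠ 0) :
    MvPolynomial.eval z (d (∏ i ∈ s, f i)) = MvPolynomial.eval z (∏ i ∈ s, f i) *
      ∑ i ∈ s, (MvPolynomial.eval z (f i))⁻¹ * MvPolynomial.eval z (d (f i)) := by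
  classical
  induction s using Finset.induction_on with
  | empty => simp
  | insert a s ha ih =>
    rw [Finset.prod_insert ha, Finset.sum_insert ha, Derivation.leibniz, map_add, smul_eq_mul,
      smul_eq_mul, map_mul, map_mul, ih fun i hi => hf i (Finset.mem_insert_of_mem hi), map_mul]
    have := hf a (Finset.mem_insert_self _ _)
    field_simp
    ring

theorem eval_euler_vand (hinj : Function.Injective z) (l : Fin n) :
    MvPolynomial.eval z (euler l (vand n)) = MvPolynomial.eval z (vand n) *
      ∑ i, ∑ j ∈ Finset.Ioi i, (z j - z i)⁻¹ *
        ((if l = j then z j else 0) - (if l = i then z i else 0)) := by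
  have hne : ∀ i : Fin n, ∀ j ∈ Finset.Ioi i, z j - z i ≠ 0 := fun i j hij =>
    sub_ne_zero.2 fun h => (Finset.mem_Ioi.1 hij).ne (hinj h).symm
  have hne' : ∀ i : Fin n, MvPolynomial.eval z
      (∏ j ∈ Finset.Ioi i, (MvPolynomial.X j - MvPolynomial.X i : MvPolynomial (Fin n) ℂ)) ≠ 0 := by
    intro i
    rw [map_prod]
    refine Finset.prod_ne_zero_iff.2 fun j hj => ?_
    simpa using hne i j hj
  rw [vand, Matrix.det_vandermonde, eval_derivation_prod _ _ _ fun i _ => hne' i]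
  congr 1
  refine Finset.sum_congr rfl fun i _ => ?_
  rw [eval_derivation_prod _ _ _ fun j hj => by simpa using hne i j hj, ← mul_assoc,
    inv_mul_cancel₀ (hne' i), one_mul]
  refine Finset.sum_congr rfl fun j _ => ?_
  have hX : ∀ k, MvPolynomial.eval z (euler l (MvPolynomial.X k)) = if l = k then z k else 0 := by
    intro k
    rw [euler_apply, MvPolynomial.pderiv_X]
    by_cases h : l = k
    · subst h; simp
    · rw [Pi.single_eq_of_ne (Ne.symm h)]; simp [h]
  rw [map_sub, map_sub, map_sub, hX, hX, MvPolynomial.eval_X, MvPolynomial.eval_X]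

theorem sum_eval_euler_vand_mul (hinj : Function.Injective z) (c : Fin n → ℂ) :
    ∑ l, MvPolynomial.eval z (euler l (vand n)) * c l = MvPolynomial.eval z (vand n) *
      ∑ i, ∑ j ∈ Finset.Ioi i, (z j - z i)⁻¹ * (z j * c j - z i * c i) := by
  simp only [eval_euler_vand hinj, mul_assoc, ← Finset.mul_sum]
  congr 1
  simp only [Finset.sum_mul]
  rw [Finset.sum_comm]
  refine Finset.sum_congr rfl fun i _ => ?_
  rw [Finset.sum_comm]
  refine Finset.sum_congr rfl fun j _ => ?_
  simp only [mul_assoc, ← Finset.mul_sum, sub_mul, ite_mul, zero_mul, Finset.sum_sub_distrib]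
  simp

/-- The product of the average with the Vandermonde polynomial is an eigenfunction of
`∑_l (X_l ∂/∂X_l)²`. -/
theorem sum_euler_euler_vand_mul (r n N : ℕ) :
    ∑ l, euler l (euler l (vand n * avgCharProd r n N)) =
      (∑ j : Fin n, ((j : ℕ) : ℂ) ^ 2 + r * N * (N + 2 * n - 1 - r)) •
        (vand n * avgCharProd r n N) := by
  rw [← sub_eq_zero]
  -- An extra factor `vand n` makes the identity trivial at points with coinciding coordinates,
  -- where the differential equation is not available.
  refine (mul_eq_zero.1 (?_ : _ * vand n = 0)).resolve_right (vand_ne_zero n)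
  refine eq_of_eval_ball fun z hz => ?_
  by_cases hinj : Function.Injective z
  swap
  · have : MvPolynomial.eval z (vand n) = 0 := by
      rw [vand, RingHom.map_det, RingHom.mapMatrix_apply]
      have : (Matrix.vandermonde fun i : Fin n => (MvPolynomial.X i : MvPolynomial (Fin n) ℂ)).map
          (MvPolynomial.eval z) = Matrix.vandermonde z := by
        ext i j; simp [Matrix.vandermonde]
      rw [this]
      exact not_not.1 fun h => hinj (Matrix.det_vandermonde_ne_zero_iff.1 h)
    rw [map_mul, this, mul_zero, map_zero]
  set F := avgCharProd r n N with hF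
  have hpde := eval_pde_avgCharProd (N := N) r hz hinj
  have heul := congrArg (MvPolynomial.eval z) (sum_euler_avgCharProd r n N)
  have hW := congrArg (MvPolynomial.eval z) (sum_euler_euler_vand (n := n))
  have hcross := sum_eval_euler_vand_mul hinj (fun l => MvPolynomial.eval z (euler l F))
  have hpair := sum_sum_Ioi_add_eq (fun l => MvPolynomial.eval z (euler l F))
  rw [map_sum, MvPolynomial.smul_eval] at heul hW
  rw [← hF] at hpde heul
  -- The singular terms of the equation and the cross terms of the Leibniz rule add up to `(z_j -
  -- z_i)(F_i + F_j)` over `z_j - z_i`, where `F_i` is the Euler derivative; all poles cancel.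
  have hcomb : ∑ i, ∑ j ∈ Finset.Ioi i, (z j - z i)⁻¹ *
        (z j * MvPolynomial.eval z (euler i F) - z i * MvPolynomial.eval z (euler j F)) +
      ∑ i, ∑ j ∈ Finset.Ioi i, (z j - z i)⁻¹ *
        (z j * MvPolynomial.eval z (euler j F) - z i * MvPolynomial.eval z (euler i F)) =
      ∑ i, ∑ j ∈ Finset.Ioi i, (MvPolynomial.eval z (euler i F) + MvPolynomial.eval z (euler j F)) := by
    rw [← Finset.sum_add_distrib]
    refine Finset.sum_congr rfl fun i _ => ?_
    rw [← Finset.sum_add_distrib]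
    refine Finset.sum_congr rfl fun j hj => ?_
    have hne : z j - z i ≠ 0 := sub_ne_zero.2 fun h => (Finset.mem_Ioi.1 hj).ne (hinj h).symm
    field_simp
    ring
  rw [map_mul, map_sub, map_zero, map_sum, MvPolynomial.smul_eval, map_mul]
  have hexp : ∀ l, MvPolynomial.eval z (euler l (euler l (vand n * F))) =
      MvPolynomial.eval z (vand n) * MvPolynomial.eval z (euler l (euler l F)) +
      2 * (MvPolynomial.eval z (euler l (vand n)) * MvPolynomial.eval z (euler l F)) +
      MvPolynomial.eval z (euler l (euler l (vand n))) * MvPolynomial.eval z F := by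
    intro l
    simp only [Derivation.leibniz, map_add, smul_eq_mul, map_mul]
    ring
  simp only [hexp, Finset.sum_add_distrib, ← Finset.mul_sum, ← Finset.sum_mul]
  rw [hcross, hW]
  refine mul_eq_zero_of_left ?_ _
  rw [heul] at hpde hpair
  linear_combination (-MvPolynomial.eval z (vand n)) * hpde +
    2 * MvPolynomial.eval z (vand n) * (hcomb + hpair)

end PDE

/-! ### Exponents of the eigenfunction -/

/-- The exponents `λ_{n-1-j} + j` of the alternant of the rectangular partition. -/
def rectExp (r N n : ℕ) (j : Fin n) : ℕ := (rect r N).rowLen j.rev + j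

/-- The exponents are `0, …, n-r-1` and `N+n-r, …, N+n-1`; the gap between them is an interval of
length `N`. -/
theorem rectExp_eq {r N n : ℕ} (hr : r ≤ n) (j : Fin n) :
    rectExp r N n j = if n - r ≤ (j : ℕ) then N + j else j := by
  rw [rectExp, rowLen_rect, Fin.val_rev]
  have := j.2
  split_ifs <;> omega

theorem sum_ite_rev {r n : ℕ} (hr : r ≤ n) (f : ℕ → ℤ) :
    ∑ j : Fin n, (if n - r ≤ (j : ℕ) then f j else 0) = ∑ k ∈ Finset.range r, f (n - r + k) := by
  rw [Fin.sum_univ_eq_sum_range (fun j => if n - r ≤ j then f j else 0) n]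
  obtain ⟨m, rfl⟩ := Nat.exists_eq_add_of_le' hr
  rw [Finset.sum_range_add, Nat.add_sub_cancel]
  rw [Finset.sum_eq_zero, zero_add]
  · exact Finset.sum_congr rfl fun k _ => if_pos (Nat.le_add_right _ _)
  · intro k hk
    exact if_neg (not_le.2 (Finset.mem_range.1 hk))

theorem sum_rectExp {r N n : ℕ} (hr : r ≤ n) :
    ∑ j, (rectExp r N n j : ℤ) = r * N + ∑ j : Fin n, ((j : ℕ) : ℤ) := by
  have h : ∀ j : Fin n, (rectExp r N n j : ℤ) = (if n - r ≤ (j : ℕ) then (N : ℤ) else 0) + (j : ℕ) := by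
    intro j; rw [rectExp_eq hr]; split_ifs <;> simp
  simp only [h]
  rw [Finset.sum_add_distrib, sum_ite_rev hr fun _ => (N : ℤ)]
  simp

theorem sum_rectExp_sq {r N n : ℕ} (hr : r ≤ n) :
    ∑ j, (rectExp r N n j : ℤ) ^ 2 =
      ∑ j : Fin n, ((j : ℕ) : ℤ) ^ 2 + r * N * (N + 2 * n - 1 - r) := by
  have h : ∀ j : Fin n, (rectExp r N n j : ℤ) ^ 2 =
      ((j : ℕ) : ℤ) ^ 2 + (if n - r ≤ (j : ℕ) then (N : ℤ) ^ 2 + 2 * N * (j : ℕ) else 0) := by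
    intro j; rw [rectExp_eq hr]; split_ifs
    · push_cast; ring
    · simp
  have hg : ∀ r m : ℕ, ∑ k ∈ Finset.range r, ((N : ℤ) ^ 2 + 2 * N * ((m + k : ℕ) : ℤ)) =
      (r : ℤ) * N * (N + 2 * (m + r) - 1 - r) := by
    intro r m
    induction r with
    | zero => simp
    | succ r ih => rw [Finset.sum_range_succ, ih]; push_cast; ring
  simp only [h]
  rw [Finset.sum_add_distrib, sum_ite_rev hr fun j => (N : ℤ) ^ 2 + 2 * N * (j : ℤ), hg]
  rw [Nat.cast_sub hr]
  ring

theorem injective_rectExp (r N n : ℕ) : Function.Injective (rectExp r N n) := by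
  refine StrictMono.injective fun i j hij => ?_
  have h := (rect r N).rowLen_anti j.rev i.rev (Fin.rev_le_rev.2 hij.le)
  have : (i : ℕ) < j := hij
  unfold rectExp
  omega

/-- Among the sets of integers of given cardinality, intervals are determined by the first two
power sums. -/
theorem eq_Ico_of_sum_eq {C : Finset ℕ} {m N : ℕ} (hcard : C.card = N)
    (hsum : ∑ x ∈ C, ((x : ℤ) - m) * (x - m - N + 1) =
      ∑ x ∈ Finset.Ico m (m + N), ((x : ℤ) - m) * (x - m - N + 1)) :
    C = Finset.Ico m (m + N) := by
  set I := Finset.Ico m (m + N) with hI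
  -- This quadratic is nonpositive on the interval and positive at the points of `C` outside it.
  -- Equal sums therefore leave no room for such points.
  set g : ℕ → ℤ := fun x => ((x : ℤ) - m) * (x - m - N + 1) with hg
  have h1 := Finset.sum_inter_add_sum_sdiff C I g
  have h2 := Finset.sum_inter_add_sum_sdiff I C g
  rw [Finset.inter_comm] at h2
  have hneg : ∑ x ∈ I \ C, g x ≤ 0 := by
    refine Finset.sum_nonpos fun x hx => ?_
    have := Finset.mem_Ico.1 (Finset.mem_sdiff.1 hx).1
    exact mul_nonpos_of_nonneg_of_nonpos (by omega) (by omega)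
  have hpos : ∀ x ∈ C \ I, 0 < g x := by
    intro x hx
    have := (Finset.mem_sdiff.1 hx).2
    rw [hI, Finset.mem_Ico, not_and_or, not_le, not_lt] at this
    -- For `N = 0` the quadratic would also vanish at `m - 1`, outside the interval.
    have hN : 0 < N := by
      rw [← hcard]
      exact Finset.card_pos.2 ⟨x, (Finset.mem_sdiff.1 hx).1⟩
    rcases this with h | h
    · exact mul_pos_of_neg_of_neg (by omega) (by omega)
    · exact mul_pos (by omega) (by omega)
  have hle : C ⊆ I := by
    rw [← Finset.sdiff_eq_empty_iff_subset]
    by_contra hne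
    have := Finset.sum_pos hpos (Finset.nonempty_iff_ne_empty.2 hne)
    simp only [hg] at *
    linarith
  refine Finset.eq_of_subset_of_card_le hle ?_
  rw [hcard, hI, Nat.card_Ico, Nat.add_sub_cancel_left]

/-- The sum of a quadratic over the complement of the exponents in `{0, …, N+n-1}` depends only on
their number and first two power sums. It thus agrees with the sum for `rectExp`, whose complement
is an interval, and `eq_Ico_of_sum_eq` applies. -/
theorem exists_perm_of_sums {r N n : ℕ} (hr : r ≤ n) {b : Fin n → ℕ} (hb : Function.Injective b)
    (hlt : ∀ i, b i < N + n) (h1 : ∑ i, (b i : ℤ) = r * N + ∑ j : Fin n, ((j : ℕ) : ℤ))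
    (h2 : ∑ i, (b i : ℤ) ^ 2 =
      ∑ j : Fin n, ((j : ℕ) : ℤ) ^ 2 + r * N * (N + 2 * n - 1 - r)) :
    ∃ σ : Equiv.Perm (Fin n), ∀ i, b i = rectExp r N n (σ i) := by
  have hcompl : ∀ c : Fin n → ℕ, Function.Injective c → (∀ i, c i < N + n) →
      ∑ i, (c i : ℤ) = r * N + ∑ j : Fin n, ((j : ℕ) : ℤ) →
      ∑ i, (c i : ℤ) ^ 2 = ∑ j : Fin n, ((j : ℕ) : ℤ) ^ 2 + r * N * (N + 2 * n - 1 - r) →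
      ∑ x ∈ Finset.range (N + n) \ Finset.univ.image c,
        ((x : ℤ) - (n - r : ℕ)) * (x - (n - r : ℕ) - N + 1) =
      ∑ x ∈ Finset.range (N + n), ((x : ℤ) - (n - r : ℕ)) * (x - (n - r : ℕ) - N + 1) -
        ((∑ j : Fin n, ((j : ℕ) : ℤ) ^ 2 + r * N * (N + 2 * n - 1 - r)) +
          (1 - N - 2 * (n - r : ℕ)) * (r * N + ∑ j : Fin n, ((j : ℕ) : ℤ)) +
          n * ((n - r : ℕ) * ((n - r : ℕ) + N - 1))) := by
    intro c hc hcl hc1 hc2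
    rw [← Finset.sum_sdiff (s₁ := Finset.univ.image c) (s₂ := Finset.range (N + n)),
      Finset.sum_image hc.injOn, ← hc1, ← hc2]
    · rw [eq_sub_iff_add_eq]
      congr 1
      have hn : (n : ℤ) = ∑ _i : Fin n, (1 : ℤ) := by simp
      rw [hn, Finset.mul_sum, Finset.sum_mul, ← Finset.sum_add_distrib, ← Finset.sum_add_distrib]
      refine Finset.sum_congr rfl fun i _ => ?_
      ring
    · intro x hx
      obtain ⟨i, _, rfl⟩ := Finset.mem_image.1 hx
      exact Finset.mem_range.2 (hcl i)
  have hcardc : ∀ c : Fin n → ℕ, Function.Injective c → (∀ i, c i < N + n) →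
      (Finset.range (N + n) \ Finset.univ.image c).card = N := by
    intro c hc hcl
    rw [Finset.card_sdiff_of_subset, Finset.card_image_of_injective _ hc, Finset.card_range,
      Finset.card_univ, Fintype.card_fin, Nat.add_sub_cancel]
    intro x hx
    obtain ⟨i, _, rfl⟩ := Finset.mem_image.1 hx
    exact Finset.mem_range.2 (hcl i)
  have he := injective_rectExp r N n
  have hel : ∀ i, rectExp r N n i < N + n := by
    intro i
    have := i.2
    rw [rectExp_eq hr]
    split_ifs <;> omega
  have hE : Finset.range (N + n) \ Finset.univ.image (rectExp r N n) =
      Finset.Ico (n - r) (n - r + N) := by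
    refine (Finset.eq_of_subset_of_card_le ?_ ?_).symm
    · intro x hx
      rw [Finset.mem_Ico] at hx
      rw [Finset.mem_sdiff, Finset.mem_range, Finset.mem_image]
      refine ⟨by omega, ?_⟩
      rintro ⟨j, _, hj⟩
      rw [rectExp_eq hr] at hj
      split_ifs at hj <;> omega
    · rw [hcardc _ he hel, Nat.card_Ico, Nat.add_sub_cancel_left]
  have hB : Finset.range (N + n) \ Finset.univ.image b = Finset.Ico (n - r) (n - r + N) := by
    refine eq_Ico_of_sum_eq (hcardc b hb hlt) ?_
    rw [hcompl b hb hlt h1 h2, ← hE,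
      hcompl _ he hel (sum_rectExp hr) (sum_rectExp_sq hr)]
  have himg : Finset.univ.image b = Finset.univ.image (rectExp r N n) := by
    have key : ∀ c : Fin n → ℕ, (∀ i, c i < N + n) →
        Finset.univ.image c = Finset.range (N + n) \ (Finset.range (N + n) \ Finset.univ.image c) := by
      intro c hcl
      rw [Finset.sdiff_sdiff_eq_self]
      intro x hx
      obtain ⟨i, _, rfl⟩ := Finset.mem_image.1 hx
      exact Finset.mem_range.2 (hcl i)
    rw [key b hlt, key _ hel, hB, hE]
  have hex : ∀ i, ∃ j, rectExp r N n j = b i := by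
    intro i
    have : b i ∈ Finset.univ.image (rectExp r N n) := by
      rw [← himg]; exact Finset.mem_image_of_mem _ (Finset.mem_univ i)
    obtain ⟨j, _, hj⟩ := Finset.mem_image.1 this
    exact ⟨j, hj⟩
  choose s hs using hex
  have hsinj : Function.Injective s := fun i j h => hb (by rw [← hs, ← hs, h])
  exact ⟨Equiv.ofBijective s (Finite.injective_iff_bijective.1 hsinj), fun i => (hs i).symm⟩

/-! ### Symmetry -/

section Identification

variable {n : ℕ}

theorem rename_charProd (r : ℕ) {N : ℕ} (A : U N) (σ : Equiv.Perm (Fin n)) :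
    MvPolynomial.rename σ (charProd r n A) = charProd r n A := by
  rw [charProd, map_mul, MvPolynomial.rename_C, map_prod]
  congr 1
  have h : ∀ l, MvPolynomial.rename σ (Polynomial.aeval
      (MvPolynomial.X l : MvPolynomial (Fin n) ℂ) (A : Matrix (Fin N) (Fin N) ℂ).charpolyRev) =
      Polynomial.aeval (MvPolynomial.X (σ l)) (A : Matrix (Fin N) (Fin N) ℂ).charpolyRev := by
    intro l
    rw [← Polynomial.aeval_algHom_apply, MvPolynomial.rename_X]
  simp only [h]
  exact Equiv.prod_comp σ fun l => Polynomial.aeval (MvPolynomial.X l : MvPolynomial (Fin n) ℂ)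
    (A : Matrix (Fin N) (Fin N) ℂ).charpolyRev

theorem coeff_avgCharProd (r N : ℕ) (b : Fin n →₀ ℕ) :
    MvPolynomial.coeff b (avgCharProd r n N) =
      ∫ A : U N, MvPolynomial.coeff b (charProd r n A) ∂(haarU N) :=
  map_avgCharProd r n N (MvPolynomial.lcoeff ℂ b)

theorem rename_avgCharProd (r N : ℕ) (σ : Equiv.Perm (Fin n)) :
    MvPolynomial.rename σ (avgCharProd r n N) = avgCharProd r n N := by
  ext b
  rw [coeff_avgCharProd]
  have := map_avgCharProd r n N
    (MvPolynomial.lcoeff ℂ b ∘ₗ (MvPolynomial.rename (R := ℂ) σ).toLinearMap)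
  refine this.trans (integral_congr_ae (Filter.Eventually.of_forall fun A => ?_))
  change MvPolynomial.coeff b (MvPolynomial.rename σ (charProd r n A)) = _
  rw [rename_charProd]

theorem rename_det_X_pow (e : Fin n → ℕ) (σ : Equiv.Perm (Fin n)) :
    MvPolynomial.rename σ
      (Matrix.of fun i j : Fin n => (MvPolynomial.X i : MvPolynomial (Fin n) ℂ) ^ e j).det =
    (Equiv.Perm.sign σ : ℂ) •
      (Matrix.of fun i j : Fin n => (MvPolynomial.X i : MvPolynomial (Fin n) ℂ) ^ e j).det := by
  have h := Matrix.det_permute σ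
    (Matrix.of fun i j : Fin n => (MvPolynomial.X i : MvPolynomial (Fin n) ℂ) ^ e j)
  rw [MvPolynomial.smul_eq_C_mul, map_intCast, ← h, AlgHom.map_det]
  congr 1
  ext1 i j
  simp

theorem rename_vand_mul (r N : ℕ) (σ : Equiv.Perm (Fin n)) :
    MvPolynomial.rename σ (vand n * avgCharProd r n N) =
      (Equiv.Perm.sign σ : ℂ) • (vand n * avgCharProd r n N) := by
  rw [map_mul, rename_avgCharProd, ← smul_mul_assoc]
  congr 1
  exact rename_det_X_pow (fun j : Fin n => (j : ℕ)) σ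

theorem coeff_mapDomain_vand_mul (r N : ℕ) (σ : Equiv.Perm (Fin n)) (b : Fin n →₀ ℕ) :
    MvPolynomial.coeff (b.mapDomain σ) (vand n * avgCharProd r n N) =
      (Equiv.Perm.sign σ : ℂ) * MvPolynomial.coeff b (vand n * avgCharProd r n N) := by
  have h := MvPolynomial.coeff_rename_mapDomain σ σ.injective (vand n * avgCharProd r n N) b
  rw [rename_vand_mul, MvPolynomial.coeff_smul, smul_eq_mul] at h
  rw [← h, ← mul_assoc]
  have : (Equiv.Perm.sign σ : ℂ) * (Equiv.Perm.sign σ : ℂ) = 1 := by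
    rcases Int.units_eq_one_or (Equiv.Perm.sign σ) with h | h <;> simp [h]
  rw [this, one_mul]

/-- Swapping two equal exponents fixes the monomial but changes the sign of its coefficient. -/
theorem injective_of_coeff_ne_zero {r N : ℕ} {b : Fin n →₀ ℕ}
    (hb : MvPolynomial.coeff b (vand n * avgCharProd r n N) ≠ 0) : Function.Injective b := by
  intro i j hij
  by_contra hne
  have h := coeff_mapDomain_vand_mul r N (Equiv.swap i j) b
  have h2 : b.mapDomain (Equiv.swap i j) = b := by
    ext k
    rw [mapDomain_perm_apply, Equiv.symm_swap]
    rcases eq_or_ne k i with rfl | hi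
    · rw [Equiv.swap_apply_left, hij]
    · rcases eq_or_ne k j with rfl | hj
      · rw [Equiv.swap_apply_right, hij]
      · rw [Equiv.swap_apply_of_ne_of_ne hi hj]
  rw [h2, Equiv.Perm.sign_swap hne] at h
  refine hb ?_
  have h3 : MvPolynomial.coeff b (vand n * avgCharProd r n N) =
      -MvPolynomial.coeff b (vand n * avgCharProd r n N) := by simpa using h
  exact self_eq_neg.1 h3

/-! ### Support of the antisymmetric eigenfunction -/

theorem degreeOf_det_X_pow_le (e : Fin n → ℕ) (D : ℕ) (he : ∀ j, e j ≤ D) (i : Fin n) :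
    MvPolynomial.degreeOf i
      (Matrix.of fun i j : Fin n => (MvPolynomial.X i : MvPolynomial (Fin n) ℂ) ^ e j).det ≤ D := by
  rw [MvPolynomial.degreeOf_le_iff]
  intro b hb
  rw [MvPolynomial.mem_support_iff, det_X_pow, MvPolynomial.coeff_sum] at hb
  obtain ⟨σ, _, hσ⟩ := Finset.exists_ne_zero_of_sum_ne_zero hb
  rw [MvPolynomial.coeff_smul, MvPolynomial.coeff_monomial] at hσ
  by_cases h : (Finsupp.equivFunOnFinite.symm e).mapDomain σ = b
  · rw [← h, mapDomain_perm_apply]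
    exact he _
  · rw [if_neg h, smul_zero] at hσ
    exact absurd rfl hσ

theorem degreeOf_avgCharProd_le (r N : ℕ) (i : Fin n) :
    MvPolynomial.degreeOf i (avgCharProd r n N) ≤ N := by
  rw [MvPolynomial.degreeOf_le_iff]
  intro b hb
  rw [MvPolynomial.mem_support_iff, coeff_avgCharProd] at hb
  by_contra! hlt
  refine hb ?_
  have : ∀ A : U N, MvPolynomial.coeff b (charProd r n A) = 0 := by
    intro A
    rw [coeff_charProd, Finset.prod_eq_zero (Finset.mem_univ i), mul_zero]
    exact Polynomial.coeff_eq_zero_of_natDegree_lt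
      (lt_of_le_of_lt (natDegree_charpolyRev_le _) hlt)
  simp [this]

theorem lt_of_coeff_ne_zero {r N : ℕ} {b : Fin n →₀ ℕ}
    (hb : MvPolynomial.coeff b (vand n * avgCharProd r n N) ≠ 0) (i : Fin n) : b i < N + n := by
  have h1 : MvPolynomial.degreeOf i (vand n) ≤ n - 1 :=
    degreeOf_det_X_pow_le (fun j : Fin n => (j : ℕ)) (n - 1) (fun j => by omega) i
  have h2 := degreeOf_avgCharProd_le r N i
  have h3 := MvPolynomial.degreeOf_mul_le i (vand n) (avgCharProd r n N)
  have h4 := MvPolynomial.degreeOf_le_iff.1 (le_refl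
    (MvPolynomial.degreeOf i (vand n * avgCharProd r n N))) b (MvPolynomial.mem_support_iff.2 hb)
  have := i.2
  omega

theorem sum_euler_vand :
    ∑ l, euler l (vand n) = (∑ j : Fin n, ((j : ℕ) : ℂ)) • vand n := by
  have h : vand n = ∑ σ : Equiv.Perm (Fin n), (Equiv.Perm.sign σ : ℂ) •
      MvPolynomial.monomial
        ((Finsupp.equivFunOnFinite.symm fun j : Fin n => (j : ℕ)).mapDomain σ) 1 := by
    rw [← det_X_pow]; rfl
  ext b
  rw [MvPolynomial.coeff_sum, MvPolynomial.coeff_smul]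
  simp only [coeff_euler]
  rw [← Finset.sum_mul, h, MvPolynomial.coeff_sum, smul_eq_mul, Finset.mul_sum, Finset.mul_sum]
  refine Finset.sum_congr rfl fun σ _ => ?_
  rw [MvPolynomial.coeff_smul, MvPolynomial.coeff_monomial]
  split_ifs with hb
  · congr 1
    rw [← hb]
    simp only [mapDomain_perm_apply]
    exact Equiv.sum_comp σ.symm (fun j : Fin n => ((j : ℕ) : ℂ))
  · simp

theorem sum_euler_vand_mul (r N : ℕ) :
    ∑ l, euler l (vand n * avgCharProd r n N) =
      (r * N + ∑ j : Fin n, ((j : ℕ) : ℂ)) • (vand n * avgCharProd r n N) := by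
  simp only [Derivation.leibniz, Finset.sum_add_distrib, smul_eq_mul, ← Finset.mul_sum]
  rw [sum_euler_avgCharProd, sum_euler_vand]
  simp only [MvPolynomial.smul_eq_C_mul, map_add]
  ring

/-- Both Euler sums act on a monomial by a scalar. Cancelling a nonzero coefficient in the two
eigenvalue equations yields the two power sums of the exponents. -/
theorem exists_mapDomain_of_coeff_ne_zero {r N : ℕ} (hr : r ≤ n) {b : Fin n →₀ ℕ}
    (hb : MvPolynomial.coeff b (vand n * avgCharProd r n N) ≠ 0) :
    ∃ σ : Equiv.Perm (Fin n),
      b = (Finsupp.equivFunOnFinite.symm (rectExp r N n)).mapDomain σ := by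
  have h1 := congrArg (MvPolynomial.coeff b) (sum_euler_vand_mul (n := n) r N)
  have h2 := congrArg (MvPolynomial.coeff b) (sum_euler_euler_vand_mul r n N)
  rw [MvPolynomial.coeff_sum, MvPolynomial.coeff_smul, smul_eq_mul] at h1 h2
  simp only [coeff_euler, ← mul_assoc, ← Finset.sum_mul] at h1 h2
  have h1' := mul_right_cancel₀ hb h1
  have h2' := mul_right_cancel₀ hb h2
  obtain ⟨σ, hσ⟩ := exists_perm_of_sums hr (injective_of_coeff_ne_zero hb)
    (lt_of_coeff_ne_zero hb) (by exact_mod_cast h1') (by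
      simp only [← pow_two] at h2'
      exact_mod_cast h2')
  refine ⟨σ⁻¹, ?_⟩
  ext i
  rw [mapDomain_perm_apply, hσ]
  rfl

/-- The support is a single permutation orbit, along which antisymmetry determines every coefficient
from one of them. -/
theorem vand_mul_avgCharProd {r N : ℕ} (hr : r ≤ n) :
    ∃ c : ℂ, vand n * avgCharProd r n N = c •
      (Matrix.of fun i j : Fin n =>
        (MvPolynomial.X i : MvPolynomial (Fin n) ℂ) ^ rectExp r N n j).det := by
  set E : Fin n →₀ ℕ := Finsupp.equivFunOnFinite.symm (rectExp r N n) with hE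
  refine ⟨MvPolynomial.coeff E (vand n * avgCharProd r n N), ?_⟩
  ext b
  rw [MvPolynomial.coeff_smul, det_X_pow, MvPolynomial.coeff_sum, ← hE, smul_eq_mul]
  simp only [MvPolynomial.coeff_smul, MvPolynomial.coeff_monomial, smul_eq_mul]
  by_cases hb : ∃ σ : Equiv.Perm (Fin n), b = E.mapDomain σ
  · obtain ⟨σ, rfl⟩ := hb
    rw [coeff_mapDomain_vand_mul, Finset.sum_eq_single σ]
    · rw [if_pos rfl]; ring
    · intro τ _ hτ
      rw [if_neg, mul_zero]
      intro h
      refine hτ (Equiv.symm_bijective.injective (Equiv.ext fun i => ?_))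
      have := DFunLike.congr_fun h i
      rw [mapDomain_perm_apply, mapDomain_perm_apply] at this
      exact injective_rectExp r N n this
    · intro h
      exact absurd (Finset.mem_univ _) h
  · rw [Finset.sum_eq_zero, mul_zero]
    · by_contra h
      exact hb (exists_mapDomain_of_coeff_ne_zero hr h)
    · intro σ _
      rw [if_neg fun h => hb ⟨σ, h.symm⟩, mul_zero]

/-! ### Identification with the Schur polynomial -/

theorem coeff_charpolyRev_card {N : ℕ} (A : Matrix (Fin N) (Fin N) ℂ) :
    A.charpolyRev.coeff N = (-1) ^ N * A.det := by
  rw [← Matrix.reverse_charpoly, Polynomial.coeff_reverse, Matrix.charpoly_natDegree_eq_dim,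
    Fintype.card_fin, Polynomial.revAt_le le_rfl, Nat.sub_self, Matrix.det_eq_sign_charpoly_coeff,
    Fintype.card_fin, ← mul_assoc, ← mul_pow]
  simp

theorem coeff_charpolyRev_zero {N : ℕ} (A : Matrix (Fin N) (Fin N) ℂ) :
    A.charpolyRev.coeff 0 = 1 := by
  rw [Polynomial.coeff_zero_eq_eval_zero, Matrix.eval_charpolyRev]

/-- The exponent vector of the monomial `∏_{i < r} X_{n-1-i}^N`. -/
def topExp (r N n : ℕ) : Fin n →₀ ℕ :=
  Finsupp.equivFunOnFinite.symm fun i => if (i.rev : ℕ) < r then N else 0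

/-- The coefficient is constant before averaging: `r` factors contribute their leading coefficient
`(-1)^N det A`, and `det(A)⁻ʳ` cancels the determinants. -/
theorem coeff_topExp_avgCharProd {r N : ℕ} (hr : r ≤ n) :
    MvPolynomial.coeff (topExp r N n) (avgCharProd r n N) = (-1) ^ (N * r) := by
  rw [coeff_avgCharProd]
  have h : ∀ A : U N, MvPolynomial.coeff (topExp r N n) (charProd r n A) = (-1) ^ (N * r) := by
    intro A
    rw [coeff_charProd]
    have h1 : ∀ l : Fin n, (A : Matrix (Fin N) (Fin N) ℂ).charpolyRev.coeff (topExp r N n l) =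
        if (l.rev : ℕ) < r then (-1) ^ N * (A : Matrix (Fin N) (Fin N) ℂ).det else 1 := by
      intro l
      change (A : Matrix (Fin N) (Fin N) ℂ).charpolyRev.coeff (if (l.rev : ℕ) < r then N else 0) = _
      split_ifs
      · exact coeff_charpolyRev_card _
      · exact coeff_charpolyRev_zero _
    have h2 : ∏ l : Fin n, (if (l.rev : ℕ) < r then
        (-1) ^ N * (A : Matrix (Fin N) (Fin N) ℂ).det else 1) =
        ((-1) ^ N * (A : Matrix (Fin N) (Fin N) ℂ).det) ^ r := by
      have := Equiv.prod_comp Fin.revPerm fun l : Fin n => if (l : ℕ) < r then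
        (-1) ^ N * (A : Matrix (Fin N) (Fin N) ℂ).det else 1
      refine this.trans ?_
      rw [Finset.prod_ite, Finset.prod_const, Finset.prod_const_one, mul_one]
      congr 1
      rw [Fin.card_filter_val_lt]
      omega
    simp only [h1]
    rw [h2, mul_pow, star_det_eq_inv, mul_left_comm, ← mul_pow,
      inv_mul_cancel₀ (isUnit_det A).ne_zero, one_pow, mul_one, pow_mul]
  simp [h]

theorem coeff_topExp_tabSum {r N : ℕ} (hr : r ≤ n) :
    MvPolynomial.coeff (topExp r N n)
      (tabSum (rect r N) fun i : Fin n => (MvPolynomial.X i : MvPolynomial (Fin n) ℂ)) = 1 := by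
  obtain ⟨T₀, hT₀, huniq⟩ := existsUnique_content_rect (N := N) hr
  have hmon : ∀ T : SSYT (rect r N) n,
      ∏ i : Fin n, (MvPolynomial.X i.rev : MvPolynomial (Fin n) ℂ) ^ T.content i =
        MvPolynomial.monomial
          ((Finsupp.equivFunOnFinite.symm fun i : Fin n => T.content i).mapDomain Fin.revPerm) 1 :=
    fun T => prod_X_pow_perm (fun i : Fin n => T.content i) Fin.revPerm
  rw [tabSum, MvPolynomial.coeff_sum]
  simp only [hmon, MvPolynomial.coeff_monomial]
  rw [Finset.sum_eq_single T₀]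
  · rw [if_pos]
    ext i
    rw [mapDomain_perm_apply]
    exact hT₀ i.rev
  · intro T _ hne
    rw [if_neg]
    intro h
    refine hne (huniq T fun i => ?_)
    have := DFunLike.congr_fun h i.rev
    rw [mapDomain_perm_apply] at this
    change T.content (i.rev.rev : Fin n) = (if (i.rev.rev : ℕ) < r then N else 0) at this
    rwa [Fin.rev_rev] at this
  · intro h
    exact absurd (Finset.mem_univ _) h

theorem avgCharProd_eq_tabSum {r N : ℕ} (hr : r ≤ n) :
    avgCharProd r n N = ((-1) ^ (N * r) : ℂ) •
      tabSum (rect r N) fun i : Fin n => (MvPolynomial.X i : MvPolynomial (Fin n) ℂ) := by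
  obtain ⟨c, hc⟩ := vand_mul_avgCharProd (N := N) hr
  have hrow : (rect r N).rowLen n = 0 := by rw [rowLen_rect, if_neg (by omega)]
  have hbi := bialternant (rect r N) hrow
    fun i : Fin n => (MvPolynomial.X i : MvPolynomial (Fin n) ℂ)
  have hdet : (Matrix.of fun i j : Fin n =>
      (MvPolynomial.X i : MvPolynomial (Fin n) ℂ) ^ rectExp r N n j).det =
      vand n * tabSum (rect r N) fun i : Fin n => (MvPolynomial.X i : MvPolynomial (Fin n) ℂ) := hbi
  rw [hdet, ← mul_smul_comm] at hc
  have h := mul_left_cancel₀ (vand_ne_zero n) hc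
  have hcoef := congrArg (MvPolynomial.coeff (topExp r N n)) h
  rw [MvPolynomial.coeff_smul, coeff_topExp_tabSum hr, coeff_topExp_avgCharProd hr, smul_eq_mul,
    mul_one] at hcoef
  rw [h, hcoef]

/-- The Haar average of `det(A)^{-r} ∏_l det(1 - X_l A)` is a rectangular Schur polynomial. -/
theorem avgCharProd_eq_schurPoly {r N : ℕ} (hr : r ≤ n) :
    avgCharProd r n N = ((-1) ^ (N * r) : ℂ) •
      MvPolynomial.map (Int.castRingHom ℂ) (schurPoly (rect r N) n) := by
  -- Symmetry of the average undoes the reversal of variables built into `tabSum`.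
  rw [← rename_avgCharProd r N Fin.revPerm, avgCharProd_eq_tabSum hr, map_smul]
  congr 1
  simp [tabSum, schurPoly]

end Identification

/-! ### Moments of the characteristic polynomial -/

theorem charP_eq_eval {N : ℕ} (A : U N) (θ : ℝ) : charP A θ =
    (A : Matrix (Fin N) (Fin N) ℂ).charpolyRev.eval (Complex.exp (-(θ * Complex.I))) :=
  (eval_charpolyRev_eq _ _).symm

/-- The functional equation: for `|w| = 1` and unitary `A`, the adjoint of `1 - wA` is `A* (-w̄)(1 -
wA)`. It expresses `|P_N|²` without conjugating the characteristic polynomial. -/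
theorem star_charP {N : ℕ} (A : U N) (θ : ℝ) : star (charP A θ) =
    star (A : Matrix (Fin N) (Fin N) ℂ).det * ((-1) ^ N * Complex.exp (θ * Complex.I) ^ N) *
      charP A θ := by
  set w := Complex.exp (-(θ * Complex.I)) with hw
  have hw' : star w = Complex.exp (θ * Complex.I) := by
    rw [hw, RCLike.star_def, ← Complex.exp_conj]
    simp
  have hww : star w * w = 1 := by
    rw [hw', hw, ← Complex.exp_add, add_neg_cancel, Complex.exp_zero]
  have h1 : star (A : Matrix (Fin N) (Fin N) ℂ) * A = 1 := Unitary.star_mul_self_of_mem A.2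
  have h2 : star (1 - w • (A : Matrix (Fin N) (Fin N) ℂ)) =
      star (A : Matrix (Fin N) (Fin N) ℂ) * (-star w • (1 - w • (A : Matrix (Fin N) (Fin N) ℂ))) := by
    rw [star_sub, star_one, star_smul, smul_sub, smul_smul, neg_mul, hww, mul_sub,
      neg_smul, neg_smul, one_smul, mul_neg, mul_neg, h1, Matrix.mul_smul, mul_one]
    abel
  have h3 : star (charP A θ) = (star (1 - w • (A : Matrix (Fin N) (Fin N) ℂ))).det :=
    (Matrix.det_conjTranspose _).symm
  have h4 : (star (A : Matrix (Fin N) (Fin N) ℂ)).det =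
      star (A : Matrix (Fin N) (Fin N) ℂ).det := Matrix.det_conjTranspose _
  rw [h3, h2, Matrix.det_mul, Matrix.det_smul, h4, Fintype.card_fin, neg_pow, hw', ← mul_assoc]
  rfl

theorem norm_charP_pow {N : ℕ} (A : U N) (θ : ℝ) (β : ℕ) : ((‖charP A θ‖ ^ (2 * β) : ℝ) : ℂ) =
    star (A : Matrix (Fin N) (Fin N) ℂ).det ^ β * (-1) ^ (N * β) *
      (Complex.exp (θ * Complex.I) ^ (N * β) * ((A : Matrix (Fin N) (Fin N) ℂ).charpolyRev.eval
        (Complex.exp (-(θ * Complex.I)))) ^ (2 * β)) := by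
  have h : ((‖charP A θ‖ ^ 2 : ℝ) : ℂ) = star (charP A θ) * charP A θ := by
    rw [RCLike.star_def, Complex.conj_mul']
    push_cast; rfl
  rw [pow_mul, Complex.ofReal_pow, h, star_charP, ← charP_eq_eval, pow_mul, pow_mul, pow_mul]
  ring

theorem prod_comp_divNat {M : Type*} [CommMonoid M] (k β : ℕ) (f : Fin k → M) :
    ∏ l : Fin (k * β), f l.divNat = ∏ j, f j ^ β := by
  rw [← Equiv.prod_comp finProdFinEquiv, Fintype.prod_prod_type]
  refine Finset.prod_congr rfl fun j _ => ?_
  have h : ∀ b : Fin β, (finProdFinEquiv (j, b)).divNat = j := by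
    intro b
    exact congrArg Prod.fst (finProdFinEquiv.symm_apply_apply (j, b))
  simp [h]

theorem prod_comp_divNat_modNat {M : Type*} [CommMonoid M] (k β : ℕ) (f : Fin k → M) :
    ∏ l : Fin (2 * (k * β)), f (Fin.divNat (Fin.modNat l)) = ∏ j, f j ^ (2 * β) := by
  rw [← Equiv.prod_comp finProdFinEquiv, Fintype.prod_prod_type]
  have h : ∀ (a : Fin 2) (b : Fin (k * β)), (finProdFinEquiv (a, b)).modNat = b := by
    intro a b
    exact congrArg Prod.snd (finProdFinEquiv.symm_apply_apply (a, b))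
  simp only [h, prod_comp_divNat, Finset.prod_const, Finset.card_univ, Fintype.card_fin,
    ← Finset.prod_pow, ← pow_mul, mul_comm β 2]

theorem eval_map_intCast {n : ℕ} (z : Fin n → ℂ) (p : MvPolynomial (Fin n) ℤ) :
    MvPolynomial.eval z (MvPolynomial.map (Int.castRingHom ℂ) p) = MvPolynomial.aeval z p := by
  rw [MvPolynomial.eval_map, MvPolynomial.aeval_def]
  rfl

theorem star_aeval {n : ℕ} (z : Fin n → ℂ) (p : MvPolynomial (Fin n) ℤ) :
    star (MvPolynomial.aeval z p) = MvPolynomial.aeval (fun i => star (z i)) p :=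
  MvPolynomial.comp_aeval_apply (fun i => z i) (starRingEnd ℂ).toIntAlgHom p

theorem expectation_prod_charP (N k β : ℕ) (θ : Fin k → ℝ) :
    ((expectationU fun A : U N => ∏ j : Fin k, ‖charP A (θ j)‖ ^ (2 * β) : ℝ) : ℂ) =
      MvPolynomial.aeval (schurVector k β θ) (schurPoly (rect (k * β) N) (2 * (k * β))) /
        ∏ j : Fin k, Complex.exp (Complex.I * N * β * θ j) := by
  set z : Fin (2 * (k * β)) → ℂ := fun i =>
    Complex.exp (-(θ (Fin.divNat (Fin.modNat i)) * Complex.I)) with hz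
  have hsign : ((-1) ^ (N * (k * β)) : ℂ) * (-1) ^ (N * (k * β)) = 1 := by
    rw [← mul_pow]; simp
  have hpt : ∀ A : U N, ((∏ j : Fin k, ‖charP A (θ j)‖ ^ (2 * β) : ℝ) : ℂ) =
      ((-1) ^ (N * (k * β)) * ∏ j : Fin k, Complex.exp (Complex.I * N * β * θ j)) *
        MvPolynomial.eval z (charProd (k * β) (2 * (k * β)) A) := by
    intro A
    rw [Complex.ofReal_prod]
    simp only [norm_charP_pow, Finset.prod_mul_distrib, Finset.prod_const, Finset.card_univ,
      Fintype.card_fin]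
    rw [charProd, map_mul, MvPolynomial.eval_C,
      eval_prod_aeval_X, hz, prod_comp_divNat_modNat k β fun j =>
        (A : Matrix (Fin N) (Fin N) ℂ).charpolyRev.eval (Complex.exp (-(θ j * Complex.I))),
      ← pow_mul, ← pow_mul]
    have h : ∀ j, Complex.exp (θ j * Complex.I) ^ (N * β) =
        Complex.exp (Complex.I * N * β * θ j) := by
      intro j
      rw [← Complex.exp_nat_mul]
      congr 1
      push_cast; ring
    simp only [h]
    rw [mul_comm β k, mul_assoc N β k, mul_comm β k]
    ring
  have hmain : ((expectationU fun A : U N => ∏ j : Fin k, ‖charP A (θ j)‖ ^ (2 * β) : ℝ) : ℂ) =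
      (∏ j : Fin k, Complex.exp (Complex.I * N * β * θ j)) *
        MvPolynomial.aeval z (schurPoly (rect (k * β) N) (2 * (k * β))) := by
    rw [expectationU, ← integral_complex_ofReal]
    simp only [hpt]
    have hL : MvPolynomial.eval z (avgCharProd (k * β) (2 * (k * β)) N) =
        ∫ A : U N, MvPolynomial.eval z (charProd (k * β) (2 * (k * β)) A) ∂(haarU N) :=
      map_avgCharProd (k * β) (2 * (k * β)) N (MvPolynomial.aeval (R := ℂ) z).toLinearMap
    rw [integral_const_mul, ← hL, avgCharProd_eq_schurPoly (by omega), MvPolynomial.smul_eval,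
      eval_map_intCast]
    linear_combination (∏ j : Fin k, Complex.exp (Complex.I * N * β * θ j)) *
      MvPolynomial.aeval z (schurPoly (rect (k * β) N) (2 * (k * β))) * hsign
  -- The average was evaluated at the points `e^{-iθ}`. The expectation is real, so conjugation
  -- moves them to `e^{iθ}` and inverts the prefactor.
  have hconj := congrArg star hmain
  rw [RCLike.star_def, Complex.conj_ofReal] at hconj
  rw [hconj, ← RCLike.star_def, star_mul', star_aeval, div_eq_mul_inv, mul_comm]
  have hv : (fun i => star (z i)) = schurVector k β θ := by
    funext i
    rw [hz, schurVector, RCLike.star_def, ← Complex.exp_conj]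
    simp
  rw [hv, star_prod, ← Finset.prod_inv_distrib]
  congr 1
  refine Finset.prod_congr rfl fun j _ => ?_
  rw [RCLike.star_def, ← Complex.exp_conj, ← Complex.exp_neg]
  simp

/-! ### Moments of moments -/

theorem integral_exp_pow_mul_eval (M : ℕ) (p : Polynomial ℂ) :
    ∫ θ in (0 : ℝ)..(2 * Real.pi), Complex.exp (θ * Complex.I) ^ M *
      p.eval (Complex.exp (-(θ * Complex.I))) = 2 * Real.pi * p.coeff M := by
  have hexp : ∀ (k : ℕ) (θ : ℝ), Complex.exp (θ * Complex.I) ^ M *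
      Complex.exp (-(θ * Complex.I)) ^ k = Complex.exp (((M : ℂ) - k) * Complex.I * θ) := by
    intro k θ
    rw [← Complex.exp_nat_mul, ← Complex.exp_nat_mul, ← Complex.exp_add]
    congr 1; ring
  have hint : ∀ k : ℕ, ∫ θ in (0 : ℝ)..(2 * Real.pi), Complex.exp (((M : ℂ) - k) * Complex.I * θ) =
      if k = M then 2 * (Real.pi : ℂ) else 0 := by
    intro k
    split_ifs with h
    · simp [h]
    · have hne : ((M : ℂ) - k) * Complex.I ≠ 0 :=
        mul_ne_zero (sub_ne_zero.2 fun hh => h (by exact_mod_cast hh.symm)) Complex.I_ne_zero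
      rw [integral_exp_mul_complex hne]
      have : ((M : ℂ) - k) * Complex.I * ((2 * Real.pi : ℝ) : ℂ) =
          ((M - k : ℤ) : ℂ) * (2 * Real.pi * Complex.I) := by push_cast; ring
      rw [this, Complex.exp_int_mul_two_pi_mul_I]
      simp
  have hsum : ∀ θ : ℝ, Complex.exp (θ * Complex.I) ^ M * p.eval (Complex.exp (-(θ * Complex.I))) =
      ∑ k ∈ Finset.range (p.natDegree + 1),
        p.coeff k * Complex.exp (((M : ℂ) - k) * Complex.I * θ) := by
    intro θ
    rw [Polynomial.eval_eq_sum_range, Finset.mul_sum]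
    refine Finset.sum_congr rfl fun k _ => ?_
    rw [← hexp]; ring
  simp only [hsum]
  rw [intervalIntegral.integral_finsetSum]
  · simp only [intervalIntegral.integral_const_mul, hint, mul_ite, mul_zero]
    rw [Finset.sum_ite_eq']
    split_ifs with h
    · ring
    · rw [Polynomial.coeff_eq_zero_of_natDegree_lt, mul_zero]
      rw [Finset.mem_range] at h
      omega
  · intro k _
    refine Continuous.intervalIntegrable ?_ _ _
    fun_prop

/-- After the functional equation the integrand is `e^{iNβθ}` times a polynomial in `e^{-iθ}`, and
orthogonality of exponentials picks one coefficient. -/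
theorem circle_average_norm_charP {N : ℕ} (A : U N) (β : ℕ) :
    (((1 / (2 * Real.pi)) * ∫ θ in (0 : ℝ)..(2 * Real.pi), ‖charP A θ‖ ^ (2 * β) : ℝ) : ℂ) =
      star (A : Matrix (Fin N) (Fin N) ℂ).det ^ β * (-1) ^ (N * β) *
        ((A : Matrix (Fin N) (Fin N) ℂ).charpolyRev ^ (2 * β)).coeff (N * β) := by
  rw [Complex.ofReal_mul, ← intervalIntegral.integral_ofReal]
  simp only [norm_charP_pow, ← Polynomial.eval_pow]
  rw [intervalIntegral.integral_const_mul, integral_exp_pow_mul_eval]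
  have : (Real.pi : ℂ) ≠ 0 := by exact_mod_cast Real.pi_ne_zero
  push_cast
  field_simp

/-- The block of `2 β` consecutive letters that contains a given letter. -/
def letterBlock (k β : ℕ) (l : Fin (2 * (k * β))) : Fin k :=
  Fin.divNat (n := 2 * β) (Fin.cast (by ring) l)

theorem prod_comp_letterBlock {M : Type*} [CommMonoid M] (k β : ℕ) (f : Fin k → M) :
    ∏ l, f (letterBlock k β l) = ∏ j, f j ^ (2 * β) := by
  rw [← prod_comp_divNat k (2 * β) f]
  have h : 2 * (k * β) = k * (2 * β) := by ring
  exact Equiv.prod_comp (finCongr h) fun l : Fin (k * (2 * β)) => f l.divNat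

theorem sum_letterBlock_content {N k β : ℕ} (hβ : 1 ≤ β)
    (T : SSYT (rect (k * β) N) (2 * (k * β))) (j : Fin k) :
    ∑ l with letterBlock k β l = j, T.content l =
      ∑ m ∈ Finset.Ico (2 * β * (j : ℕ)) (2 * β * ((j : ℕ) + 1)), T.content m := by
  have hmem : ∀ l : Fin (2 * (k * β)), letterBlock k β l = j ↔
      2 * β * (j : ℕ) ≤ l ∧ (l : ℕ) < 2 * β * ((j : ℕ) + 1) := by
    intro l
    rw [Fin.ext_iff]
    change (l : ℕ) / (2 * β) = j ↔ _
    rw [Nat.div_eq_iff (by omega)]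
    have h1 : (j : ℕ) * (2 * β) = 2 * β * j := by ring
    have h2 : 2 * β * ((j : ℕ) + 1) = 2 * β * j + 2 * β := by ring
    omega
  refine Finset.sum_bij (fun l _ => (l : ℕ)) ?_ ?_ ?_ ?_
  · intro l hl
    rw [Finset.mem_filter] at hl
    rw [Finset.mem_Ico]
    exact (hmem l).1 hl.2
  · intro l _ l' _ h
    exact Fin.ext h
  · intro m hm
    rw [Finset.mem_Ico] at hm
    have hj : (j : ℕ) + 1 ≤ k := j.2
    have h1 : 2 * β * ((j : ℕ) + 1) ≤ 2 * (k * β) := by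
      calc 2 * β * ((j : ℕ) + 1) ≤ 2 * β * k := Nat.mul_le_mul_left _ hj
        _ = 2 * (k * β) := by ring
    refine ⟨⟨m, hm.2.trans_le h1⟩, ?_, rfl⟩
    rw [Finset.mem_filter]
    exact ⟨Finset.mem_univ _, (hmem _).2 hm⟩
  · intro l _
    rfl

/-- Merging the `2β` variables of each block into one leaves a monomial that records only how many
entries lie in each block. -/
theorem coeff_rename_schurPoly {N k β : ℕ} (hβ : 1 ≤ β) :
    MvPolynomial.coeff (Finsupp.equivFunOnFinite.symm fun _ : Fin k => N * β)
      (MvPolynomial.rename (letterBlock k β) (MvPolynomial.map (Int.castRingHom ℂ)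
        (schurPoly (rect (k * β) N) (2 * (k * β))))) = (numRSSYT N k β : ℂ) := by
  classical
  have hmon : ∀ T : SSYT (rect (k * β) N) (2 * (k * β)),
      ∏ l, (MvPolynomial.X (letterBlock k β l) : MvPolynomial (Fin k) ℂ) ^ T.content l =
        MvPolynomial.monomial (Finsupp.equivFunOnFinite.symm fun j : Fin k =>
          ∑ m ∈ Finset.Ico (2 * β * (j : ℕ)) (2 * β * ((j : ℕ) + 1)), T.content m) 1 := by
    intro T
    rw [MvPolynomial.monomial_eq, Finsupp.prod_fintype _ _ fun _ => pow_zero _, map_one, one_mul,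
      ← Finset.prod_fiberwise Finset.univ (letterBlock k β)]
    refine Finset.prod_congr rfl fun j _ => ?_
    rw [Finsupp.equivFunOnFinite_symm_apply_apply, ← sum_letterBlock_content hβ,
      ← Finset.prod_pow_eq_pow_sum]
    refine Finset.prod_congr rfl fun l hl => ?_
    rw [(Finset.mem_filter.1 hl).2]
  simp only [schurPoly, map_sum, map_prod, map_pow, MvPolynomial.map_X, MvPolynomial.rename_X,
    hmon, MvPolynomial.coeff_sum, MvPolynomial.coeff_monomial]
  rw [numRSSYT, Nat.card_eq_fintype_card, Fintype.card_subtype, Finset.sum_boole]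
  congr 2
  refine Finset.filter_congr fun T _ => ?_
  rw [Equiv.apply_eq_iff_eq, funext_iff]
  rfl

/-- For fixed `A` the `k`-th power of the circle average is already, up to sign, a coefficient of
the block-merged `charProd`. Only linearity of the Haar average remains, with no interchange of
integrals. Since all factors of `charProd` are the same polynomial, merging consecutive variables is
as good as any other grouping. -/
theorem mom_eq_numRSSYT {N k β : ℕ} (hβ : 1 ≤ β) : Mom N k β = numRSSYT N k β := by
  have hsign : ((-1) ^ (N * (k * β)) : ℂ) * (-1) ^ (N * (k * β)) = 1 := by
    rw [← mul_pow]; simp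
  let L : MvPolynomial (Fin (2 * (k * β))) ℂ →ₗ[ℂ] ℂ :=
    MvPolynomial.lcoeff ℂ (Finsupp.equivFunOnFinite.symm fun _ : Fin k => N * β) ∘ₗ
      (MvPolynomial.rename (R := ℂ) (letterBlock k β)).toLinearMap
  have hL : ∀ p, L p = MvPolynomial.coeff (Finsupp.equivFunOnFinite.symm fun _ : Fin k => N * β)
      (MvPolynomial.rename (letterBlock k β) p) := fun p => rfl
  have hpt : ∀ A : U N,
      ((((1 / (2 * Real.pi)) * ∫ θ in (0 : ℝ)..(2 * Real.pi), ‖charP A θ‖ ^ (2 * β)) ^ k : ℝ) : ℂ) =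
        (-1) ^ (N * (k * β)) * L (charProd (k * β) (2 * (k * β)) A) := by
    intro A
    have hren : MvPolynomial.rename (letterBlock k β) (charProd (k * β) (2 * (k * β)) A) =
        MvPolynomial.C (star (A : Matrix (Fin N) (Fin N) ℂ).det ^ (k * β)) *
          ∏ j, Polynomial.aeval (MvPolynomial.X j : MvPolynomial (Fin k) ℂ)
            ((A : Matrix (Fin N) (Fin N) ℂ).charpolyRev ^ (2 * β)) := by
      rw [charProd, map_mul, MvPolynomial.rename_C, map_prod]
      simp only [← Polynomial.aeval_algHom_apply, MvPolynomial.rename_X, map_pow]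
      rw [prod_comp_letterBlock k β fun j => Polynomial.aeval
        (MvPolynomial.X j : MvPolynomial (Fin k) ℂ) (A : Matrix (Fin N) (Fin N) ℂ).charpolyRev]
    rw [Complex.ofReal_pow, circle_average_norm_charP, hL, hren, MvPolynomial.coeff_C_mul,
      coeff_prod_aeval_X]
    simp only [Finsupp.equivFunOnFinite_symm_apply_apply, Finset.prod_const, Finset.card_univ,
      Fintype.card_fin]
    rw [mul_pow, mul_pow, ← pow_mul, ← pow_mul, mul_comm β k, mul_assoc N β k, mul_comm β k]
    ring
  have h : (Mom N k β : ℂ) = (numRSSYT N k β : ℂ) := by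
    rw [Mom, expectationU, ← integral_complex_ofReal]
    simp only [hpt]
    rw [integral_const_mul, ← map_avgCharProd, avgCharProd_eq_schurPoly (by omega), map_smul, hL,
      coeff_rename_schurPoly hβ, smul_eq_mul, ← mul_assoc, hsign, one_mul]
  exact_mod_cast h

/-- The restriction is simply dropped and all tableaux of the rectangle are counted. -/
theorem numRSSYT_le (N k β : ℕ) : numRSSYT N k β ≤ (N + 1) ^ (k ^ 2 * β ^ 2) := by
  rw [← mul_pow]
  exact (Nat.card_le_card_of_injective _ Subtype.val_injective).trans (card_SSYT_rect_le _ _)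

end
end CUE

theorem proposition2p1 (k β : ℕ) (hk : 1 ≤ k) (hβ : 1 ≤ β) :
    (∀ N : ℕ, 1 ≤ N → ∀ θ : Fin k → ℝ,
      ((CUE.expectationU fun A : CUE.U N => ∏ j : Fin k, ‖CUE.charP A (θ j)‖ ^ (2 * β) : ℝ) : ℂ) =
        MvPolynomial.aeval (CUE.schurVector k β θ)
            (CUE.schurPoly (CUE.rect (k * β) N) (2 * (k * β))) /
          ∏ j : Fin k, Complex.exp (Complex.I * N * β * θ j)) ∧
    (∀ N : ℕ, 1 ≤ N → CUE.Mom N k β = CUE.numRSSYT N k β) ∧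
    (∃ p : Polynomial ℝ, p.natDegree = k ^ 2 * β ^ 2 ∧
      ∀ N : ℕ, 1 ≤ N → CUE.Mom N k β ≤ p.eval (N : ℝ)) := by
  refine ⟨fun N _ θ => CUE.expectation_prod_charP N k β θ, fun N _ => CUE.mom_eq_numRSSYT hβ,
    (Polynomial.X + Polynomial.C 1) ^ (k ^ 2 * β ^ 2), ?_, fun N _ => ?_⟩
  · rw [Polynomial.natDegree_pow, Polynomial.natDegree_X_add_C, mul_one]
  · rw [CUE.mom_eq_numRSSYT hβ, Polynomial.eval_pow, Polynomial.eval_add, Polynomial.eval_X,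
      Polynomial.eval_C]
    exact_mod_cast CUE.numRSSYT_le N k β
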